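/- Let $n$ be an odd positive integer. Let $\Omega_n^{t\&h}$ be the polytope of all real $n\times n$ doubly stochastic matrices $A=[a_{ij}]$ that are symmetric ($a_{ij}=a_{ji}$) and Hankel symmetric ($a_{ij}=a_{n+1-j,\,n+1-i}$). The loopy graph $G(A)$ of $A\in\Omega_n^{t\&h}$ has vertex set $\{1,\dots,n\}$ and one edge joining $i$ and $j$ exactly when $a_{ij}\neq 0$ (a loop if $i=j$). A loop counts as a cycle of length $1$; all other cycles have length at least $3$. Call $c=(n+1)/2$ the central vertex and let $\rho(i)=n+1-i$. If $A$ is an extreme point of $\Omega_n^{t\&h}$, then the connected component of $G(A)$ containing $c$ is of one of the following three types: (a) an odd cycle (possibly a loop) containing $c$; (b) two distinct odd cycles of the same length (possibly loops) and a path of even length (possibly zero) with $c$ at its centre that joins a vertex of one cycle to a vertex of the other, the cycles and the path being otherwise disjoint; if the path has length zero (so that the two cycles share exactly the vertex $c$), the two cycles are interchanged by $\rho$; (c) an even cycle (of length at least $4$) bisected by a path of even nonzero length with $c$ at its centre, that is, the path joins two opposite vertices of the cycle and is otherwise disjoint from it, and the two halves into which these vertices divide the cycle are interchanged by $\rho$.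 Conversely, every matrix in $\Omega_n^{t\&h}$ whose loopy graph is connected and is of type (a), (b) or (c) is an extreme point of $\Omega_n^{t\&h}$. -/

import Mathlib

open scoped Graph

/-- The Hankel transpose: reflection of a matrix about its antidiagonal. `Fin.rev i` is the index
written `n + 1 - i` when rows and columns are numbered from `1`. -/
def hankelTranspose {n : ℕ} (A : Matrix (Fin n) (Fin n) ℝ) : Matrix (Fin n) (Fin n) ℝ :=
  Matrix.of fun i j => A j.rev i.rev

/-- The polytope of symmetric and Hankel-symmetric doubly stochastic `n × n` matrices. -/
def OmegaTH (n : ℕ) : Set (Matrix (Fin n) (Fin n) ℝ) :=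
  {A | A ∈ doublyStochastic ℝ (Fin n) ∧ A.IsSymm ∧ hankelTranspose A = A}

/-- The loopy graph of a matrix: all indices are vertices, and there is one edge joining `i` and `j`
(a loop if `i = j`) exactly when the entry `(i, j)` is nonzero. The two orders of the indices are
both mentioned only so that the definition makes sense for all matrices; for a symmetric matrix the
two alternatives coincide. -/
def loopyGraph {n : ℕ} (A : Matrix (Fin n) (Fin n) ℝ) : Graph (Fin n) (Sym2 (Fin n)) where
  vertexSet := Set.univ
  IsLink e i j := e = s(i, j) ∧ (A i j ≠ 0 ∨ A j i ≠ 0)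
  isLink_symm := by
    intro e _
    refine ⟨fun i j h => ?_⟩
    exact ⟨h.1.trans Sym2.eq_swap, h.2.symm⟩
  eq_or_eq_of_isLink_of_isLink := by
    intro e x y v w h h'
    have h2 : s(x, y) = s(v, w) := h.1.symm.trans h'.1
    rw [Sym2.eq_iff] at h2
    rcases h2 with h2 | h2
    · exact Or.inl h2.1
    · exact Or.inr h2.1
  left_mem_of_isLink := fun _ _ _ _ => Set.mem_univ _

section Shapes

variable {V β : Type*}

/-- Two vertices are joined by a walk. -/
def GraphReachable (G : Graph V β) (u v : V) : Prop := Relation.ReflTransGen G.Adj u v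

/-- A graph is connected if it has a vertex and any two of its vertices are joined by a walk. -/
def GraphConnected (G : Graph V β) : Prop :=
  V(G).Nonempty ∧ ∀ u ∈ V(G), ∀ v ∈ V(G), GraphReachable G u v

/-- The connected component of `G` containing the vertex `c`. -/
def componentOf (G : Graph V β) (c : V) : Graph V β := G.induce {v | GraphReachable G c v}

/-- The edges `{w j, w (j + 1)}` of the cycle with vertices `w 0, …, w (k - 1)` in cyclic order.
For `k = 1` this is a single loop at `w 0`. -/
def cycleEdges {k : ℕ} (w : ZMod k → V) : Set (Sym2 V) := Set.range fun j => s(w j, w (j + 1))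

/-- The edges `{p i, p (i + 1)}` of the path with vertices `p 0, …, p l`. -/
def pathEdges {l : ℕ} (p : Fin (l + 1) → V) : Set (Sym2 V) :=
  Set.range fun i : Fin l => s(p i.castSucc, p i.succ)

/-- `H` has exactly the vertices in `S` and the adjacencies in `E`. -/
def ConsistsOf (H : Graph V β) (S : Set V) (E : Set (Sym2 V)) : Prop :=
  V(H) = S ∧ ∀ x y, H.Adj x y ↔ s(x, y) ∈ E

/-- Type (a): `H` is an odd cycle (possibly of length `1`, that is, a loop) containing `c`. -/
def IsTypeA (H : Graph V β) (c : V) : Prop :=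
  ∃ (k : ℕ) (w : ZMod k → V), Odd k ∧ Function.Injective w ∧ c ∈ Set.range w ∧
    ConsistsOf H (Set.range w) (cycleEdges w)

/-- Type (b): `H` consists of two distinct odd cycles `w`, `w'` of the same length `k` (loops if
`k = 1`) and a path `p` of even length `2 * s` (possibly `s = 0`) with centre `c`, which joins a
vertex of the first cycle to a vertex of the second; the cycles and the path share no vertices but
these. If the path has length zero, so that the two cycles share precisely the vertex `c`, the
reflection `ρ` interchanges the two cycles. -/
def IsTypeB (H : Graph V β) (c : V) (ρ : V → V) : Prop :=
  ∃ (k s : ℕ) (w w' : ZMod k → V) (p : Fin (2 * s + 1) → V),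
    Odd k ∧ Function.Injective w ∧ Function.Injective w' ∧ Function.Injective p ∧
    Set.range w ≠ Set.range w' ∧
    p 0 = w 0 ∧ p (Fin.last (2 * s)) = w' 0 ∧ p ⟨s, by omega⟩ = c ∧
    Set.range w ∩ Set.range p = {w 0} ∧ Set.range w' ∩ Set.range p = {w' 0} ∧
    Set.range w ∩ Set.range w' ⊆ Set.range p ∧
    (s = 0 → ρ '' Set.range w = Set.range w') ∧
    ConsistsOf H (Set.range w ∪ Set.range w' ∪ Set.range p)
      (cycleEdges w ∪ cycleEdges w' ∪ pathEdges p)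

/-- Type (c): `H` consists of a cycle `w` of even length `2 * l ≥ 4` and a path `p` of even nonzero
length `2 * s` with centre `c`, which joins two opposite vertices of the cycle and is otherwise
disjoint from it; the reflection `ρ` interchanges the two halves into which the ends of the path
divide the cycle. -/
def IsTypeC (H : Graph V β) (c : V) (ρ : V → V) : Prop :=
  ∃ (l s : ℕ) (w : ZMod (2 * l) → V) (p : Fin (2 * s + 1) → V),
    2 ≤ l ∧ 1 ≤ s ∧ Function.Injective w ∧ Function.Injective p ∧
    p 0 = w 0 ∧ p (Fin.last (2 * s)) = w (l : ZMod (2 * l)) ∧ p ⟨s, by omega⟩ = c ∧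
    Set.range w ∩ Set.range p = {w 0, w (l : ZMod (2 * l))} ∧
    ρ '' ((fun j : ℕ => w (j : ZMod (2 * l))) '' Set.Icc 0 l) =
      (fun j : ℕ => w (j : ZMod (2 * l))) '' Set.Icc l (2 * l) ∧
    ConsistsOf H (Set.range w ∪ Set.range p) (cycleEdges w ∪ pathEdges p)

end Shapes

/-- The vertex written `(n + 1) / 2` when the vertices are numbered from `1`; it is number
`(n - 1) / 2` when they are numbered from `0`. -/
def centralVertex {n : ℕ} (hn : Odd n) : Fin n :=
  ⟨(n - 1) / 2, by have := hn.pos; omega⟩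

/-- `H` is of one of the three types, with respect to the central vertex and the reflection
`i ↦ n + 1 - i` of the vertices. -/
def IsCentralType {n : ℕ} (hn : Odd n) (H : Graph (Fin n) (Sym2 (Fin n))) : Prop :=
  IsTypeA H (centralVertex hn) ∨ IsTypeB H (centralVertex hn) Fin.rev ∨
    IsTypeC H (centralVertex hn) Fin.rev

/-!
A matrix `A` of the polytope is extreme if and only if its support is *rigid*: no nonzero symmetric
and Hankel symmetric matrix on the edges of `G(A)` has zero row sums. Put `δ x` for the sum of the
indicators of `x` and `ρ x`. A symmetrized edge `{x, y}` has row sums `δ x + δ y`, so alternating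
sums along a walk from `x` to `y` realize `δ x ± δ y`.

Let the support be rigid. No edge of `G(A)` with a further edge at one end is pendant at the other
end, so a walk that starts in the central vertex `c` and never turns back returns to itself or to
its mirror image under `ρ`. Up to its first return, say at time `t` to the vertex of time `i` or to
the mirror image of that vertex, the walk and its mirror image form one of the three configurations
if `t - i` is odd. If `t - i` were even, an alternating sum would realize the row sums of an edge
that it avoids, contradicting rigidity. Hence `t - i` is odd, and the closed part of the walk
realizes `2 δ x`, so that `δ x` is realized at every vertex of the configuration. Then rigidity
forbids any further edge between these vertices. An edge leaving them could be prolonged forever,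
since `δ` is also realized at its new end.

Conversely, if all row sums are `r`, then subtracting `r / 2` from the entries makes them alternate
along every stretch of vertices of degree two. By symmetry the two edges of the path at `c` carry
equal entries, so all entries on the path are `r / 2`. For `r = 0` the odd cycles then carry only
zeros. In type (c) the entries on the two half-cycles of length `l` are equal by symmetry, and the
row sum at their common end vertex excludes an even `l` for `r = 1` and forces zero entries for
`r = 0` and odd `l`.
-/

section Polyhedron

open Filter Topology

variable {M ι : Type*} [AddCommGroup M] [Module ℝ M]

lemma exists_pos_forall_mul_abs_le [Finite ι] {a x : ι → ℝ} (ha : ∀ i, 0 ≤ a i)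
    (hx : ∀ i, a i = 0 → x i = 0) : ∃ ε > 0, ∀ i, ε * |x i| ≤ a i := by
  have eventually_le (i : ι) : ∀ᶠ ε in 𝓝[>] (0 : ℝ), ε * |x i| ≤ a i := by
    rcases (ha i).eq_or_lt with h0 | hpos
    · simp [hx i h0.symm, ← h0]
    · have tendsto : Tendsto (fun ε : ℝ => ε * |x i|) (𝓝[>] 0) (𝓝 0) := by
        simpa using ((continuous_mul_const |x i|).tendsto 0).mono_left nhdsWithin_le_nhds
      exact (tendsto.eventually (gt_mem_nhds hpos)).mono fun _ => le_of_lt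
  obtain ⟨ε, hε, hle⟩ := (eventually_mem_nhdsWithin.and (eventually_all.2 eventually_le)).exists
  exact ⟨ε, hε, hle⟩

lemma mem_extremePoints_polyhedron_iff [Finite ι] (φ : ι → M →ₗ[ℝ] ℝ) (T : Submodule ℝ M) {A : M}
    (hA : ∀ i, 0 ≤ φ i A) :
    A ∈ Set.extremePoints ℝ {B | (∀ i, 0 ≤ φ i B) ∧ B - A ∈ T} ↔
      ∀ X ∈ T, (∀ i, φ i A = 0 → φ i X = 0) → X = 0 := by
  rw [mem_extremePoints_iff_left]
  constructor
  · rintro ⟨-, h⟩ X hX hsupp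
    obtain ⟨ε, hε, hle⟩ := exists_pos_forall_mul_abs_le hA hsupp
    have add_mem (σ : ℝ) (hσ : |σ| = ε) :
        A + σ • X ∈ {B | (∀ i, 0 ≤ φ i B) ∧ B - A ∈ T} := by
      refine ⟨fun i => ?_, by simpa using T.smul_mem σ hX⟩
      have := neg_abs_le (σ * φ i X)
      rw [abs_mul, hσ] at this
      simp only [map_add, map_smul, smul_eq_mul]
      linarith [hle i]
    have mem_segment : A ∈ openSegment ℝ (A + ε • X) (A + -ε • X) :=
      ⟨1 / 2, 1 / 2, by norm_num, by norm_num, by norm_num, by module⟩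
    have := h _ (add_mem ε (abs_of_pos hε)) _ (add_mem (-ε) (by rw [abs_neg, abs_of_pos hε]))
      mem_segment
    simpa [hε.ne'] using this
  · refine fun h => ⟨⟨hA, by simp⟩, fun B hB C hC ⟨a, b, ha, hb, hab, hABC⟩ => ?_⟩
    have sub_eq_zero_of_eq (i : ι) (hi : φ i A = 0) : φ i (B - C) = 0 := by
      have hsum : a * φ i B + b * φ i C = 0 := by simpa [← hABC] using hi
      rw [add_eq_zero_iff_of_nonneg (mul_nonneg ha.le (hB.1 i)) (mul_nonneg hb.le (hC.1 i))]
        at hsum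
      simp_all [ha.ne', hb.ne']
    have hBC : B = C := sub_eq_zero.1 <|
      h _ (by simpa using T.sub_mem hB.2 hC.2) sub_eq_zero_of_eq
    rw [← hABC, ← hBC, ← add_smul, hab, one_smul]

end Polyhedron

section Bisymmetric

variable {V : Type*} {ρ : V → V} {E : Set (Sym2 V)} {X : Matrix V V ℝ}

/-- Symmetric matrices that are invariant under `ρ` and whose nonzero entries lie on edges of `E`.
For a symmetric matrix, invariance under `Fin.rev` is Hankel symmetry. -/
structure IsBisymmetric (ρ : V → V) (E : Set (Sym2 V)) (X : Matrix V V ℝ) : Prop where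
  symm : ∀ x y, X x y = X y x
  map : ∀ x y, X (ρ x) (ρ y) = X x y
  eq_zero : ∀ x y, s(x, y) ∉ E → X x y = 0

lemma IsBisymmetric.mem_of_ne_zero (hX : IsBisymmetric ρ E X) {x y : V} (h : X x y ≠ 0) :
    s(x, y) ∈ E :=
  not_imp_comm.1 (hX.eq_zero x y) h

lemma IsBisymmetric.mono {F : Set (Sym2 V)} (hX : IsBisymmetric ρ E X) (hEF : E ⊆ F) :
    IsBisymmetric ρ F X where
  symm := hX.symm
  map := hX.map
  eq_zero x y h := hX.eq_zero x y fun hE => h (hEF hE)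

/-- The space of matrices satisfying `IsBisymmetric ρ E`. -/
def bisymmetric (ρ : V → V) (E : Set (Sym2 V)) : Submodule ℝ (Matrix V V ℝ) where
  carrier := {X | IsBisymmetric ρ E X}
  zero_mem' := ⟨by simp, by simp, by simp⟩
  add_mem' hX hY := ⟨fun x y => by simp [hX.symm x y, hY.symm x y],
    fun x y => by simp [hX.map x y, hY.map x y],
    fun x y h => by simp [hX.eq_zero x y h, hY.eq_zero x y h]⟩
  smul_mem' a X hX := ⟨fun x y => by simp [hX.symm x y], fun x y => by simp [hX.map x y],
    fun x y h => by simp [hX.eq_zero x y h]⟩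

/-- The edges of the loopy graph of `A`. -/
def entrySupport (A : Matrix V V ℝ) : Set (Sym2 V) := {e | ∃ x y, s(x, y) = e ∧ A x y ≠ 0}

lemma mk_mem_entrySupport {A : Matrix V V ℝ} {x y : V} :
    s(x, y) ∈ entrySupport A ↔ A x y ≠ 0 ∨ A y x ≠ 0 := by
  constructor
  · rintro ⟨a, b, hab, h⟩
    rcases Sym2.eq_iff.1 hab with ⟨rfl, rfl⟩ | ⟨rfl, rfl⟩
    · exact Or.inl h
    · exact Or.inr h
  · rintro (h | h)
    · exact ⟨x, y, rfl, h⟩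
    · exact ⟨y, x, Sym2.eq_swap, h⟩

lemma IsBisymmetric.mk_mem_entrySupport (hX : IsBisymmetric ρ E X) {x y : V} :
    s(x, y) ∈ entrySupport X ↔ X x y ≠ 0 := by
  rw [_root_.mk_mem_entrySupport, hX.symm y x, or_self]

lemma IsBisymmetric.self_entrySupport (hX : IsBisymmetric ρ E X) :
    IsBisymmetric ρ (entrySupport X) X where
  symm := hX.symm
  map := hX.map
  eq_zero _ _ h := by_contra fun hne => h (hX.mk_mem_entrySupport.2 hne)

lemma IsBisymmetric.mapsTo_entrySupport (hX : IsBisymmetric ρ E X) :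
    Set.MapsTo (Sym2.map ρ) (entrySupport X) (entrySupport X) := by
  rintro _ ⟨x, y, rfl, h⟩
  exact ⟨ρ x, ρ y, rfl, by rwa [hX.map]⟩

variable [Fintype V]

/-- Matrices as linear maps to their vectors of row sums. -/
def rowSum : Matrix V V ℝ →ₗ[ℝ] V → ℝ where
  toFun X := X.mulVec 1
  map_add' X Y := X.add_mulVec Y 1
  map_smul' a X := Matrix.smul_mulVec a X 1

lemma rowSum_apply (X : Matrix V V ℝ) (x : V) : rowSum X x = ∑ y, X x y := by
  simp [rowSum, Matrix.mulVec, dotProduct]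

/-- No nonzero bisymmetric matrix on the edges of `E` has zero row sums, that is, a matrix of
`OmegaTH` with support `E` cannot be perturbed inside `OmegaTH`. -/
def IsRigid (ρ : V → V) (E : Set (Sym2 V)) : Prop :=
  ∀ X, IsBisymmetric ρ E X → rowSum X = 0 → X = 0

end Bisymmetric

section Polytope

variable {n : ℕ} {A : Matrix (Fin n) (Fin n) ℝ}

lemma loopyGraph_adj {x y : Fin n} : (loopyGraph A).Adj x y ↔ s(x, y) ∈ entrySupport A :=
  ⟨fun ⟨_, _, h⟩ => mk_mem_entrySupport.2 h, fun h => ⟨_, rfl, mk_mem_entrySupport.1 h⟩⟩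

lemma mem_OmegaTH_iff :
    A ∈ OmegaTH n ↔ (∀ x y, 0 ≤ A x y) ∧ IsBisymmetric Fin.rev Set.univ A ∧ rowSum A = 1 := by
  simp only [OmegaTH, Set.mem_ofPred_eq, mem_doublyStochastic_iff_sum, funext_iff, rowSum_apply,
    Pi.one_apply]
  constructor
  · rintro ⟨⟨nonneg, row, -⟩, symm, hankel⟩
    refine ⟨nonneg, ⟨fun x y => symm.apply y x, fun x y => ?_, by simp⟩, row⟩
    exact (congrFun₂ hankel y x).trans (symm.apply x y)
  · rintro ⟨nonneg, hA, row⟩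
    refine ⟨⟨nonneg, row, fun y => ?_⟩, Matrix.IsSymm.ext fun x y => hA.symm y x, ?_⟩
    · simpa only [hA.symm _ y] using row y
    · exact Matrix.ext fun x y => (hA.map y x).trans (hA.symm y x)

lemma mem_extremePoints_OmegaTH_iff (hA : A ∈ OmegaTH n) :
    A ∈ Set.extremePoints ℝ (OmegaTH n) ↔ IsRigid Fin.rev (entrySupport A) := by
  obtain ⟨nonneg, hA, row⟩ := mem_OmegaTH_iff.1 hA
  let φ (i : Fin n × Fin n) : Matrix (Fin n) (Fin n) ℝ →ₗ[ℝ] ℝ := Matrix.entryLinearMap ℝ ℝ i.1 i.2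
  let T : Submodule ℝ (Matrix (Fin n) (Fin n) ℝ) :=
    bisymmetric Fin.rev Set.univ ⊓ LinearMap.ker rowSum
  have polyhedron_eq : OmegaTH n = {B | (∀ i, 0 ≤ φ i B) ∧ B - A ∈ T} := by
    ext B
    have sub_mem_iff : B - A ∈ bisymmetric Fin.rev Set.univ ↔ IsBisymmetric Fin.rev Set.univ B :=
      Submodule.sub_mem_iff_left _ hA
    simp only [mem_OmegaTH_iff, Set.mem_ofPred_eq, Prod.forall, φ, T, Submodule.mem_inf,
      sub_mem_iff, LinearMap.mem_ker, map_sub, row, sub_eq_zero, Matrix.entryLinearMap_apply]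
  rw [polyhedron_eq, mem_extremePoints_polyhedron_iff φ T fun i => nonneg i.1 i.2]
  constructor
  · exact fun h X hX hrow => h X ⟨hX.mono (Set.subset_univ _), hrow⟩ fun i hi =>
      hX.eq_zero _ _ (by simpa [hA.mk_mem_entrySupport] using show A i.1 i.2 = 0 from hi)
  · exact fun h X hX hsupp => h X ⟨hX.1.symm, hX.1.map, fun x y hxy => hsupp (x, y)
      (show A x y = 0 by simpa [hA.mk_mem_entrySupport] using hxy)⟩ hX.2

end Polytope

section Edges

variable {V : Type*}

lemma left_mem_range_of_mem_cycleEdges {k : ℕ} {w : ZMod k → V} {x y : V}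
    (h : s(x, y) ∈ cycleEdges w) : x ∈ Set.range w := by
  obtain ⟨j, hj⟩ := h
  rcases Sym2.eq_iff.1 hj with ⟨rfl, rfl⟩ | ⟨rfl, rfl⟩ <;> exact Set.mem_range_self _

lemma eq_or_eq_of_mem_cycleEdges {k : ℕ} {w : ZMod k → V} (hw : Function.Injective w) {j : ZMod k}
    {y : V} (h : s(w j, y) ∈ cycleEdges w) : y = w (j - 1) ∨ y = w (j + 1) := by
  obtain ⟨i, hi⟩ := h
  rcases Sym2.eq_iff.1 hi with ⟨hij, rfl⟩ | ⟨rfl, hij⟩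
  · exact Or.inr (by rw [hw hij])
  · exact Or.inl (by rw [← hw hij, add_sub_cancel_right])

variable {l : ℕ} {p : Fin (l + 1) → V}

/-- The vertices of a path indexed by natural numbers (which are read modulo `l + 1`), so that a
path can be followed as a walk `ℕ → V`. -/
def pathVertex (p : Fin (l + 1) → V) (i : ℕ) : V := p (Fin.ofNat (l + 1) i)

lemma pathVertex_of_lt (p : Fin (l + 1) → V) {i : ℕ} (hi : i < l + 1) :
    pathVertex p i = p ⟨i, hi⟩ :=
  congrArg p (Fin.ext (Nat.mod_eq_of_lt hi))

lemma pathVertex_inj (hp : Function.Injective p) {i j : ℕ} (hi : i ≤ l) (hj : j ≤ l) :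
    pathVertex p i = pathVertex p j ↔ i = j := by
  rw [pathVertex_of_lt p (Nat.lt_succ_of_le hi), pathVertex_of_lt p (Nat.lt_succ_of_le hj),
    hp.eq_iff, Fin.mk.injEq]

lemma mem_pathEdges_iff {e : Sym2 V} :
    e ∈ pathEdges p ↔ ∃ i < l, s(pathVertex p i, pathVertex p (i + 1)) = e := by
  have mk_eq (i : Fin l) : s(p i.castSucc, p i.succ) = s(pathVertex p i, pathVertex p (i + 1)) := by
    rw [pathVertex_of_lt p (by omega), pathVertex_of_lt p (by omega)]
    rfl
  simp only [pathEdges, Set.mem_range, mk_eq]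
  exact ⟨fun ⟨i, hi⟩ => ⟨i, i.2, hi⟩, fun ⟨i, hi, he⟩ => ⟨⟨i, hi⟩, he⟩⟩

lemma left_mem_range_of_mem_pathEdges {x y : V} (h : s(x, y) ∈ pathEdges p) : x ∈ Set.range p := by
  obtain ⟨j, hj⟩ := h
  rcases Sym2.eq_iff.1 hj with ⟨rfl, rfl⟩ | ⟨rfl, rfl⟩ <;> exact Set.mem_range_self _

lemma eq_or_eq_of_mem_pathEdges (hp : Function.Injective p) {i : ℕ} (hi : i ≤ l) {y : V}
    (h : s(pathVertex p i, y) ∈ pathEdges p) :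
    (0 < i ∧ y = pathVertex p (i - 1)) ∨ (i < l ∧ y = pathVertex p (i + 1)) := by
  obtain ⟨j, hj, hij⟩ := mem_pathEdges_iff.1 h
  rcases Sym2.eq_iff.1 hij with ⟨hji, rfl⟩ | ⟨rfl, hji⟩
  · rw [pathVertex_inj hp hj.le hi] at hji
    exact Or.inr ⟨hji ▸ hj, by rw [hji]⟩
  · rw [pathVertex_inj hp hj hi] at hji
    exact Or.inl ⟨by omega, by rw [← hji, Nat.succ_sub_one]⟩

end Edges

section Entries

variable {V : Type*} [Fintype V] {ρ : V → V} {E : Set (Sym2 V)} {X : Matrix V V ℝ} {r : ℝ}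

lemma IsBisymmetric.rowSum_apply_eq_sum (hX : IsBisymmetric ρ E X) {x : V} {S : Finset V}
    (hS : ∀ y, s(x, y) ∈ E → y ∈ S) : rowSum X x = ∑ y ∈ S, X x y := by
  rw [rowSum_apply]
  exact (Finset.sum_subset S.subset_univ fun y _ hy => hX.eq_zero x y (mt (hS y) hy)).symm

lemma IsBisymmetric.rowSum_apply_eq_add (hX : IsBisymmetric ρ E X) {x y z : V} (hyz : y ≠ z)
    (hx : ∀ u, s(x, u) ∈ E → u = y ∨ u = z) : rowSum X x = X x y + X x z := by
  classical
  rw [hX.rowSum_apply_eq_sum (S := {y, z}) fun u hu => by simpa using hx u hu,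
    Finset.sum_pair hyz]

lemma IsBisymmetric.rowSum_apply_eq_add_add (hX : IsBisymmetric ρ E X) {x y z y' z' : V}
    (hyz : y ≠ z) (hyz' : y' ≠ z') (hdisj : ∀ u, u = y ∨ u = z → u = y' ∨ u = z' → False)
    (hx : ∀ u, s(x, u) ∈ E → (u = y ∨ u = z) ∨ u = y' ∨ u = z') :
    rowSum X x = (X x y + X x z) + (X x y' + X x z') := by
  classical
  have disjoint : Disjoint {y, z} ({y', z'} : Finset V) :=
    Finset.disjoint_left.2 fun u hu hu' => hdisj u (by simpa using hu) (by simpa using hu')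
  rw [hX.rowSum_apply_eq_sum (S := {y, z} ∪ {y', z'}) fun u hu => by
      simpa [or_assoc, or_left_comm] using hx u hu,
    Finset.sum_union disjoint, Finset.sum_pair hyz, Finset.sum_pair hyz']

lemma alternating_apply {x : ℕ → ℝ} {m : ℕ} (h : ∀ j, j + 1 < m → x j + x (j + 1) = 0) {j : ℕ}
    (hj : j < m) : x j = (-1) ^ j * x 0 := by
  induction j with
  | zero => simp
  | succ j ih =>
    rw [← neg_eq_of_add_eq_zero_right (h j hj), ih (by omega), pow_succ]
    ring

lemma IsBisymmetric.alternating_walk (hX : IsBisymmetric ρ E X) (hr : ∀ x, rowSum X x = r)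
    {v : ℕ → V} {m : ℕ} (hne : ∀ j, j + 1 < m → v j ≠ v (j + 2))
    (hnbr : ∀ j, j + 1 < m → ∀ y, s(v (j + 1), y) ∈ E → y = v j ∨ y = v (j + 2)) {j : ℕ}
    (hj : j < m) : X (v j) (v (j + 1)) - r / 2 = (-1) ^ j * (X (v 0) (v 1) - r / 2) := by
  refine alternating_apply (x := fun j => X (v j) (v (j + 1)) - r / 2) (fun i hi => ?_) hj
  have := hX.rowSum_apply_eq_add (hne i hi) (hnbr i hi)
  rw [hr, hX.symm _ (v i)] at this
  linarith

lemma IsBisymmetric.alternating_cycle (hX : IsBisymmetric ρ E X) (hr : ∀ x, rowSum X x = r)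
    {k : ℕ} {w : ZMod k → V} (hw : Function.Injective w) (hk : (2 : ZMod k) ≠ 0) {a : ZMod k}
    {m : ℕ} (hnbr : ∀ j < m, 0 < j → ∀ y, s(w (a + j), y) ∈ E → s(w (a + j), y) ∈ cycleEdges w)
    {j : ℕ} (hj : j < m) :
    X (w (a + j)) (w (a + j + 1)) - r / 2 = (-1) ^ j * (X (w a) (w (a + 1)) - r / 2) := by
  have alternating := hX.alternating_walk hr (v := fun j => w (a + j)) (m := m)
    (fun i _ h => hk (by simpa using hw h)) (fun i hi y hy => ?_) hj
  · simpa [add_assoc] using alternating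
  · have := eq_or_eq_of_mem_cycleEdges hw (hnbr (i + 1) hi i.succ_pos y hy)
    convert this using 3 <;> push_cast <;> ring

lemma two_ne_zero_of_odd {k : ℕ} (hk : Odd k) (h1 : k ≠ 1) : (2 : ZMod k) ≠ 0 := by
  intro h
  have dvd : k ∣ 2 := (ZMod.natCast_eq_zero_iff 2 k).1 (by exact_mod_cast h)
  rcases (Nat.dvd_prime Nat.prime_two).1 dvd with rfl | rfl
  · exact h1 rfl
  · exact Nat.not_odd_iff_even.2 even_two hk

lemma IsBisymmetric.odd_cycle_neg_one_apply (hX : IsBisymmetric ρ E X) (hr : ∀ x, rowSum X x = 0)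
    {k : ℕ} {w : ZMod k → V} (hk : Odd k) (h1 : k ≠ 1) (hw : Function.Injective w)
    (hnbr : ∀ j ≠ 0, ∀ y, s(w j, y) ∈ E → s(w j, y) ∈ cycleEdges w) :
    X (w 0) (w (-1)) = X (w 0) (w 1) ∧ (X (w 0) (w 1) = 0 → ∀ j, X (w j) (w (j + 1)) = 0) := by
  have alternating {j : ℕ} (hj : j < k) : X (w j) (w (j + 1)) = (-1) ^ j * X (w 0) (w 1) := by
    have := hX.alternating_cycle hr hw (two_ne_zero_of_odd hk h1) (a := 0) (m := k)
      (fun i hi hpos => hnbr _ fun h0 => ?_) hj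
    · simpa using this
    · rw [zero_add, ZMod.natCast_eq_zero_iff] at h0
      exact absurd (Nat.le_of_dvd hpos h0) (by omega)
  have : NeZero k := ⟨hk.pos.ne'⟩
  constructor
  · have last := alternating (Nat.sub_lt hk.pos one_pos)
    rw [Nat.cast_pred hk.pos, (Nat.Odd.sub_odd hk odd_one).neg_one_pow] at last
    simpa [hX.symm (w (-1))] using last
  · intro h0 j
    simpa [h0] using alternating (ZMod.val_lt j)

lemma IsBisymmetric.odd_cycle_apply_eq_zero (hX : IsBisymmetric ρ E X) (hr : ∀ x, rowSum X x = 0)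
    {k : ℕ} {w : ZMod k → V} (hk : Odd k) (hw : Function.Injective w)
    (hnbr : ∀ j y, s(w j, y) ∈ E → s(w j, y) ∈ cycleEdges w) (j : ZMod k) :
    X (w j) (w (j + 1)) = 0 := by
  have nbr_zero {y : V} (hy : s(w 0, y) ∈ E) : y = w (-1) ∨ y = w 1 := by
    simpa using eq_or_eq_of_mem_cycleEdges hw (hnbr 0 y hy)
  by_cases h1 : k = 1
  · subst h1
    have row := hX.rowSum_apply_eq_sum (x := w 0) (S := {w 0}) fun y hy => by
      simpa [Subsingleton.elim (-1 : ZMod 1) 0, Subsingleton.elim (1 : ZMod 1) 0] using nbr_zero hy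
    rw [Subsingleton.elim j 0, Subsingleton.elim (0 + 1 : ZMod 1) 0]
    simpa [hr] using row.symm
  · obtain ⟨neg_one, eq_zero⟩ := hX.odd_cycle_neg_one_apply hr hk h1 hw fun j _ => hnbr j
    have ne : w (-1) ≠ w 1 := fun h =>
      two_ne_zero_of_odd hk h1 (by linear_combination -hw h)
    have row := hX.rowSum_apply_eq_add ne fun _ => nbr_zero
    exact eq_zero (by linarith [hr (w 0)]) j

lemma IsBisymmetric.apply_center (hX : IsBisymmetric ρ E X) (hr : ∀ x, rowSum X x = r)
    (hE : Set.MapsTo (Sym2.map ρ) E E) {c : V} (hc : ∀ x, ρ x = x ↔ x = c) {y z : V}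
    (hyz : y ≠ z) (hyc : y ≠ c) (hy : s(c, y) ∈ E) (hnbr : ∀ u, s(c, u) ∈ E → u = y ∨ u = z) :
    X c y = r / 2 := by
  have ρ_c : ρ c = c := (hc c).2 rfl
  have ρ_y : ρ y = z :=
    (hnbr _ (by simpa [ρ_c] using hE hy)).resolve_left fun h => hyc ((hc y).1 h)
  have apply_eq : X c z = X c y := by simpa [ρ_c, ρ_y] using hX.map c y
  linarith [hX.rowSum_apply_eq_add hyz hnbr, hr c]

lemma IsBisymmetric.path_apply (hX : IsBisymmetric ρ E X) (hr : ∀ x, rowSum X x = r)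
    (hE : Set.MapsTo (Sym2.map ρ) E E) {c : V} (hc : ∀ x, ρ x = x ↔ x = c) {s : ℕ}
    {p : Fin (2 * s + 1) → V} (hp : Function.Injective p) (hmid : p ⟨s, by omega⟩ = c)
    (hpE : pathEdges p ⊆ E) (hnbr : ∀ x ∈ Set.range p, x ≠ p 0 → x ≠ p (Fin.last _) →
      ∀ y, s(x, y) ∈ E → s(x, y) ∈ pathEdges p) {x y : V} (hxy : s(x, y) ∈ pathEdges p) :
    X x y = r / 2 := by
  set v := pathVertex p
  have inj {i j : ℕ} (hi : i ≤ 2 * s) (hj : j ≤ 2 * s) (h : v i = v j) : i = j :=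
    (pathVertex_inj hp hi hj).1 h
  have v_mid : v s = c := (pathVertex_of_lt p (by omega)).trans hmid
  have nbr (j : ℕ) (hj : j + 1 < 2 * s) (y : V) (hy : s(v (j + 1), y) ∈ E) :
      y = v j ∨ y = v (j + 2) := by
    have := eq_or_eq_of_mem_pathEdges hp hj.le (hnbr (v (j + 1)) (Set.mem_range_self _)
      (fun h => absurd (inj hj.le (j := 0) (by omega) h) (by omega)) (fun h => ?_) y hy)
    · exact this.imp And.right And.right
    · rw [Fin.last, ← pathVertex_of_lt p] at h
      exact absurd (inj hj.le le_rfl h) (by omega)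
  have alternating {j : ℕ} (hj : j < 2 * s) :
      X (v j) (v (j + 1)) - r / 2 = (-1) ^ j * (X (v 0) (v 1) - r / 2) :=
    hX.alternating_walk hr (v := v)
      (fun j hj h => absurd (inj (by omega) (by omega) h) (by omega)) nbr hj
  obtain ⟨i, hi, hixy⟩ := mem_pathEdges_iff.1 hxy
  obtain ⟨t, rfl⟩ : ∃ t, s = t + 1 := ⟨s - 1, by omega⟩
  have middle : X (v t) (v (t + 1)) = r / 2 := by
    rw [hX.symm, v_mid]
    refine hX.apply_center hr hE hc (z := v (t + 2)) (fun h => ?_) (fun h => ?_) (hpE ?_) ?_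
    · exact absurd (inj (by omega) (by omega) h) (by omega)
    · exact absurd (inj (by omega) (by omega) (h.trans v_mid.symm)) (by omega)
    · exact mem_pathEdges_iff.2 ⟨t, by omega, by rw [← v_mid, Sym2.eq_swap]⟩
    · exact v_mid ▸ nbr t (by omega)
  have first : X (v 0) (v 1) - r / 2 = 0 := by
    simpa [middle] using (alternating (j := t) (by omega)).symm
  have apply_eq : X (v i) (v (i + 1)) = r / 2 := by
    simpa [first, sub_eq_zero] using alternating hi
  rcases Sym2.eq_iff.1 hixy with ⟨rfl, rfl⟩ | ⟨rfl, rfl⟩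
  · exact apply_eq
  · exact (hX.symm _ _).trans apply_eq

end Entries

section Configurations

variable {V : Type*}

/-- The configuration of type (b): two odd cycles joined by a path with centre `c`. -/
structure IsDumbbell (ρ : V → V) (c : V) {k s : ℕ} (w w' : ZMod k → V) (p : Fin (2 * s + 1) → V) :
    Prop where
  odd : Odd k
  left_injective : Function.Injective w
  right_injective : Function.Injective w'
  path_injective : Function.Injective p
  range_ne : Set.range w ≠ Set.range w'
  path_zero : p 0 = w 0
  path_last : p (Fin.last (2 * s)) = w' 0
  path_mid : p ⟨s, by omega⟩ = c
  left_inter_path : Set.range w ∩ Set.range p = {w 0}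
  right_inter_path : Set.range w' ∩ Set.range p = {w' 0}
  left_inter_right : Set.range w ∩ Set.range w' ⊆ Set.range p
  image_range : s = 0 → ρ '' Set.range w = Set.range w'

/-- The configuration of type (c): a cycle bisected by a path with centre `c`. -/
structure IsBisectedCycle (ρ : V → V) (c : V) {l s : ℕ} (w : ZMod (2 * l) → V)
    (p : Fin (2 * s + 1) → V) : Prop where
  two_le : 2 ≤ l
  one_le : 1 ≤ s
  cycle_injective : Function.Injective w
  path_injective : Function.Injective p
  path_zero : p 0 = w 0
  path_last : p (Fin.last (2 * s)) = w (l : ZMod (2 * l))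
  path_mid : p ⟨s, by omega⟩ = c
  cycle_inter_path : Set.range w ∩ Set.range p = {w 0, w (l : ZMod (2 * l))}
  image_half : ρ '' ((fun j : ℕ => w (j : ZMod (2 * l))) '' Set.Icc 0 l) =
    (fun j : ℕ => w (j : ZMod (2 * l))) '' Set.Icc l (2 * l)

end Configurations

section DumbbellSets

variable {V : Type*} {ρ : V → V} {c : V} {k s : ℕ} {w w' : ZMod k → V} {p : Fin (2 * s + 1) → V}

lemma IsDumbbell.inter_subset (h : IsDumbbell ρ c w w' p) :
    Set.range w ∩ Set.range w' ⊆ {w 0} ∩ {w' 0} := fun _ hx =>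
  ⟨h.left_inter_path.subset ⟨hx.1, h.left_inter_right hx⟩,
    h.right_inter_path.subset ⟨hx.2, h.left_inter_right hx⟩⟩

lemma IsDumbbell.mem_pathEdges (h : IsDumbbell ρ c w w' p) {x y : V} (hx : x ∈ Set.range p)
    (hx0 : x ≠ p 0) (hxl : x ≠ p (Fin.last _))
    (hxy : s(x, y) ∈ cycleEdges w ∪ cycleEdges w' ∪ pathEdges p) : s(x, y) ∈ pathEdges p := by
  rw [h.path_zero] at hx0
  rw [h.path_last] at hxl
  rcases hxy with (hxy | hxy) | hxy
  · exact absurd (h.left_inter_path.subset ⟨left_mem_range_of_mem_cycleEdges hxy, hx⟩) hx0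
  · exact absurd (h.right_inter_path.subset ⟨left_mem_range_of_mem_cycleEdges hxy, hx⟩) hxl
  · exact hxy

end DumbbellSets

section BisectedCycleSets

variable {V : Type*} {ρ : V → V} {c : V} {l s : ℕ} {w : ZMod (2 * l) → V} {p : Fin (2 * s + 1) → V}

lemma IsBisectedCycle.natCast_inj (h : IsBisectedCycle ρ c w p) {i j : ℕ} (hi : i < 2 * l)
    (hj : j < 2 * l) : w i = w j ↔ i = j := by
  rw [h.cycle_injective.eq_iff, ZMod.natCast_eq_natCast_iff', Nat.mod_eq_of_lt hi,
    Nat.mod_eq_of_lt hj]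

lemma IsBisectedCycle.map_zero (h : IsBisectedCycle ρ c w p) (hρ : Function.Involutive ρ)
    (hc : ∀ x, ρ x = x ↔ x = c) : ρ (w 0) = w l := by
  have := h.two_le
  have mem_upper : ρ (w 0) ∈ (fun j : ℕ => w j) '' Set.Icc l (2 * l) :=
    h.image_half ▸ ⟨_, ⟨0, by simp, by simp⟩, rfl⟩
  have mem_lower : ρ (w 0) ∈ (fun j : ℕ => w j) '' Set.Icc 0 l := by
    have mem : w 0 ∈ ρ '' ((fun j : ℕ => w j) '' Set.Icc 0 l) :=
      h.image_half ▸ ⟨2 * l, ⟨by omega, le_rfl⟩, by simp⟩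
    obtain ⟨x, hx, hx0⟩ := mem
    rwa [← hx0, hρ]
  have ne_zero : ρ (w 0) ≠ w 0 := by
    rw [Ne, hc, ← h.path_zero, ← h.path_mid, h.path_injective.eq_iff, Fin.ext_iff]
    exact Nat.ne_of_lt h.one_le
  obtain ⟨i, ⟨-, hi⟩, hiw⟩ := mem_lower
  obtain ⟨j, ⟨hlj, hj⟩, hjw⟩ := mem_upper
  rcases hj.eq_or_lt with rfl | hj
  · exact absurd (hjw.symm.trans (congrArg w (ZMod.natCast_self _))) ne_zero
  · have : i = j := (h.natCast_inj (by omega) hj).1 (hiw.trans hjw.symm)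
    rw [← hiw, show i = l by omega]

lemma IsBisectedCycle.mem_pathEdges (h : IsBisectedCycle ρ c w p) {x y : V} (hx : x ∈ Set.range p)
    (hx0 : x ≠ p 0) (hxl : x ≠ p (Fin.last _)) (hxy : s(x, y) ∈ cycleEdges w ∪ pathEdges p) :
    s(x, y) ∈ pathEdges p := by
  refine hxy.resolve_left fun hxy => ?_
  rcases h.cycle_inter_path.subset ⟨left_mem_range_of_mem_cycleEdges hxy, hx⟩ with rfl | rfl
  exacts [hx0 h.path_zero.symm, hxl h.path_last.symm]

lemma IsBisectedCycle.mem_cycleEdges (h : IsBisectedCycle ρ c w p) {x y : V}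
    (hx : x ∈ Set.range w) (hx0 : x ≠ w 0) (hxl : x ≠ w l)
    (hxy : s(x, y) ∈ cycleEdges w ∪ pathEdges p) : s(x, y) ∈ cycleEdges w :=
  hxy.resolve_right fun hxy =>
    (h.cycle_inter_path.subset ⟨hx, left_mem_range_of_mem_pathEdges hxy⟩).elim hx0 hxl

lemma IsBisectedCycle.map_one (h : IsBisectedCycle ρ c w p) (hρ : Function.Involutive ρ)
    (hc : ∀ x, ρ x = x ↔ x = c) (hE : Set.MapsTo (Sym2.map ρ) (cycleEdges w ∪ pathEdges p)
      (cycleEdges w ∪ pathEdges p)) : ρ (w 1) = w (l + 1) := by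
  have := h.two_le
  have map_zero := h.map_zero hρ hc
  have one_ne (j : ℕ) (hj : j < 2 * l) (hj1 : j ≠ 1) : w 1 ≠ w j := fun h1 =>
    hj1 ((h.natCast_inj hj (by omega)).1 (by rw [Nat.cast_one, h1]))
  have edge : s(ρ (w 1), w l) ∈ cycleEdges w ∪ pathEdges p := by
    rw [Sym2.eq_swap, ← map_zero]
    exact hE (x := s(w 0, w 1)) (Or.inl ⟨0, by simp only [zero_add]⟩)
  obtain ⟨j, ⟨hlj, hj⟩, hjw⟩ : ρ (w 1) ∈ (fun j : ℕ => w j) '' Set.Icc l (2 * l) :=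
    h.image_half ▸ ⟨_, ⟨1, ⟨zero_le_one, by omega⟩, by simp⟩, rfl⟩
  have ne_zero : ρ (w 1) ≠ w 0 := fun h1 =>
    one_ne l (by omega) (by omega) (by rw [← map_zero, ← h1, hρ])
  have ne_l : ρ (w 1) ≠ w l := fun h1 =>
    one_ne 0 (by omega) (by omega) <| by
      rw [Nat.cast_zero, ← hρ.injective.eq_iff, map_zero, h1]
  have cycle_edge := h.mem_cycleEdges ⟨j, hjw⟩ ne_zero ne_l edge
  rcases eq_or_eq_of_mem_cycleEdges h.cycle_injective (Sym2.eq_swap ▸ cycle_edge) with h1 | h1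
  · have j_ne : j ≠ 2 * l := by
      rintro rfl
      exact ne_zero (hjw.symm.trans (congrArg w (ZMod.natCast_self _)))
    have : j = l - 1 := (h.natCast_inj (by omega) (by omega)).1 <|
      hjw.trans (by rw [h1, Nat.cast_pred (by omega)])
    omega
  · exact h1

lemma IsBisectedCycle.apply_opposite (h : IsBisectedCycle ρ c w p) (hρ : Function.Involutive ρ)
    (hc : ∀ x, ρ x = x ↔ x = c)
    (hE : Set.MapsTo (Sym2.map ρ) (cycleEdges w ∪ pathEdges p) (cycleEdges w ∪ pathEdges p))
    {X : Matrix V V ℝ}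
    (hX : IsBisymmetric ρ (cycleEdges w ∪ pathEdges p) X) :
    X (w l) (w (l + 1)) = X (w 0) (w 1) := by
  rw [← h.map_zero hρ hc, ← h.map_one hρ hc hE, hX.map]

end BisectedCycleSets

section Rigidity

variable {V : Type*} {ρ : V → V} {E : Set (Sym2 V)} {X : Matrix V V ℝ} {c : V}

lemma IsBisymmetric.eq_zero_of_forall_mem (hX : IsBisymmetric ρ E X)
    (h : ∀ x y, s(x, y) ∈ E → X x y = 0) : X = 0 :=
  Matrix.ext fun x y => (em (s(x, y) ∈ E)).elim (h x y) (hX.eq_zero x y)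

lemma IsBisymmetric.apply_of_mem_cycleEdges (hX : IsBisymmetric ρ E X) {k : ℕ} {w : ZMod k → V}
    {a : ℝ} (h : ∀ j, X (w j) (w (j + 1)) = a) {x y : V} (hxy : s(x, y) ∈ cycleEdges w) :
    X x y = a := by
  obtain ⟨j, hj⟩ := hxy
  rcases Sym2.eq_iff.1 hj with ⟨rfl, rfl⟩ | ⟨rfl, rfl⟩
  · exact h j
  · exact (hX.symm _ _).trans (h j)

lemma mem_cycleEdges_of_mem_union {k : ℕ} {w w' : ZMod k → V} {x y : V} (hx : x ∉ Set.range w')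
    (h : s(x, y) ∈ cycleEdges w ∪ cycleEdges w') : s(x, y) ∈ cycleEdges w :=
  h.resolve_right fun h' => hx (left_mem_range_of_mem_cycleEdges h')

variable [Fintype V]

lemma isRigid_cycleEdges {k : ℕ} {w : ZMod k → V} (hk : Odd k) (hw : Function.Injective w) :
    IsRigid ρ (cycleEdges w) := by
  intro X hX hr
  exact hX.eq_zero_of_forall_mem fun x y => hX.apply_of_mem_cycleEdges
    (hX.odd_cycle_apply_eq_zero (congrFun hr) hk hw fun _ _ => id)

lemma isRigid_of_disjoint_cycles {k : ℕ} {w w' : ZMod k → V} (hk : Odd k)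
    (hw : Function.Injective w) (hw' : Function.Injective w')
    (hdisj : Disjoint (Set.range w) (Set.range w')) :
    IsRigid ρ (cycleEdges w ∪ cycleEdges w') := by
  intro X hX hr
  refine hX.eq_zero_of_forall_mem fun x y hxy => hxy.elim ?_ ?_
  · exact hX.apply_of_mem_cycleEdges (hX.odd_cycle_apply_eq_zero (congrFun hr) hk hw
      fun j y => mem_cycleEdges_of_mem_union (hdisj.notMem_of_mem_left ⟨j, rfl⟩))
  · rw [Set.union_comm] at hX
    exact hX.apply_of_mem_cycleEdges (hX.odd_cycle_apply_eq_zero (congrFun hr) hk hw'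
      fun j y => mem_cycleEdges_of_mem_union (hdisj.notMem_of_mem_right ⟨j, rfl⟩))

lemma IsBisymmetric.bouquet_center_apply_eq_zero {k : ℕ} {w w' : ZMod k → V}
    (hX : IsBisymmetric ρ (cycleEdges w ∪ cycleEdges w') X) (hr : rowSum X c = 0) (hc : ρ c = c)
    (two_ne : (2 : ZMod k) ≠ 0) (hw : Function.Injective w) (hw' : Function.Injective w')
    (h0 : w 0 = c) (h0' : w' 0 = c) (hinter : Set.range w ∩ Set.range w' ⊆ {c})
    (hmaps : Set.MapsTo ρ (Set.range w) (Set.range w')) (neg_one : X c (w (-1)) = X c (w 1))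
    (neg_one' : X c (w' (-1)) = X c (w' 1)) : X c (w 1) = 0 ∧ X c (w' 1) = 0 := by
  have one_ne : (1 : ZMod k) ≠ 0 := fun h => two_ne (by linear_combination 2 * h)
  have notMem {y : V} (hy : y = w (-1) ∨ y = w 1) : y ∉ Set.range w' := by
    have notMem_of_ne {j : ZMod k} (hj : j ≠ 0) : w j ∉ Set.range w' := fun h =>
      hj (hw ((hinter ⟨⟨j, rfl⟩, h⟩).trans h0.symm))
    rcases hy with rfl | rfl
    exacts [notMem_of_ne (neg_ne_zero.2 one_ne), notMem_of_ne one_ne]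
  have nbr {y : V} (hy : s(c, y) ∈ cycleEdges w) : y = w (-1) ∨ y = w 1 := by
    simpa using eq_or_eq_of_mem_cycleEdges hw (j := 0) (h0.symm ▸ hy)
  have nbr' {y : V} (hy : s(c, y) ∈ cycleEdges w') : y = w' (-1) ∨ y = w' 1 := by
    simpa using eq_or_eq_of_mem_cycleEdges hw' (j := 0) (h0'.symm ▸ hy)
  have row : X c (w 1) + X c (w' 1) = 0 := by
    have := hX.rowSum_apply_eq_add_add (fun h => two_ne (by linear_combination -hw h))
      (fun h => two_ne (by linear_combination -hw' h))
      (fun y hy hy' => notMem hy (by rcases hy' with rfl | rfl <;> exact Set.mem_range_self _))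
      (fun y hy => hy.imp nbr nbr')
    linarith
  have apply_eq (hne : X c (w 1) ≠ 0) : X c (w 1) = X c (w' 1) := by
    have map_apply : X c (ρ (w 1)) = X c (w 1) := by simpa [hc] using hX.map c (w 1)
    rcases hX.mem_of_ne_zero (map_apply.trans_ne hne) with edge | edge
    · exact absurd (hmaps ⟨1, rfl⟩) (notMem (nbr edge))
    · rcases nbr' edge with h | h <;> rw [← map_apply, h]
      exact neg_one'
  by_cases hne : X c (w 1) = 0
  · exact ⟨hne, by linarith⟩
  · exact absurd (by linarith [apply_eq hne]) hne

lemma isRigid_of_bouquet (hc : ρ c = c) {k : ℕ} {w w' : ZMod k → V} (hk : Odd k)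
    (h1 : k ≠ 1) (hw : Function.Injective w) (hw' : Function.Injective w') (h0 : w 0 = c)
    (h0' : w' 0 = c) (hinter : Set.range w ∩ Set.range w' ⊆ {c})
    (hmaps : Set.MapsTo ρ (Set.range w) (Set.range w')) :
    IsRigid ρ (cycleEdges w ∪ cycleEdges w') := by
  intro X hX hr
  obtain ⟨neg_one, left_zero⟩ := hX.odd_cycle_neg_one_apply (congrFun hr) hk h1 hw
    fun j hj y => mem_cycleEdges_of_mem_union fun h =>
      hj (hw ((hinter ⟨⟨j, rfl⟩, h⟩).trans h0.symm))
  have hX' : IsBisymmetric ρ (cycleEdges w' ∪ cycleEdges w) X := Set.union_comm _ _ ▸ hX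
  obtain ⟨neg_one', right_zero⟩ := hX'.odd_cycle_neg_one_apply (congrFun hr) hk h1 hw'
    fun j hj y => mem_cycleEdges_of_mem_union fun h =>
      hj (hw' ((hinter ⟨h, ⟨j, rfl⟩⟩).trans h0'.symm))
  rw [h0] at neg_one left_zero
  rw [h0'] at neg_one' right_zero
  obtain ⟨left, right⟩ := hX.bouquet_center_apply_eq_zero (congrFun hr c) hc
    (two_ne_zero_of_odd hk h1) hw hw' h0 h0' hinter hmaps neg_one neg_one'
  refine hX.eq_zero_of_forall_mem fun x y hxy => hxy.elim ?_ ?_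
  · exact hX.apply_of_mem_cycleEdges (left_zero left)
  · exact hX.apply_of_mem_cycleEdges (right_zero right)

lemma IsDumbbell.isRigid {k s : ℕ} {w w' : ZMod k → V} {p : Fin (2 * s + 1) → V}
    (h : IsDumbbell ρ c w w' p) (hc : ∀ x, ρ x = x ↔ x = c)
    (hE : Set.MapsTo (Sym2.map ρ) (cycleEdges w ∪ cycleEdges w' ∪ pathEdges p)
      (cycleEdges w ∪ cycleEdges w' ∪ pathEdges p)) :
    IsRigid ρ (cycleEdges w ∪ cycleEdges w' ∪ pathEdges p) := by
  intro X hX hr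
  have path_zero {x y : V} (hxy : s(x, y) ∈ pathEdges p) : X x y = 0 := by
    simpa using hX.path_apply (r := 0) (congrFun hr) hE hc h.path_injective h.path_mid
      Set.subset_union_right (fun x hx hx0 hxl y => h.mem_pathEdges hx hx0 hxl) hxy
  have hX' : IsBisymmetric ρ (cycleEdges w ∪ cycleEdges w') X :=
    ⟨hX.symm, hX.map, fun x y hxy => (em (s(x, y) ∈ pathEdges p)).elim path_zero
      fun hp => hX.eq_zero x y fun hE => hE.elim hxy hp⟩
  rcases Nat.eq_zero_or_pos s with rfl | hs
  · have w_zero : w 0 = c := h.path_zero.symm.trans h.path_mid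
    have w_zero' : w' 0 = c := h.path_last.symm.trans h.path_mid
    have ne_one : k ≠ 1 := by
      rintro rfl
      exact h.range_ne (by
        rw [Set.range_unique, Set.range_unique, Subsingleton.elim default 0, w_zero, w_zero'])
    exact isRigid_of_bouquet ((hc c).2 rfl) h.odd ne_one h.left_injective h.right_injective w_zero
      w_zero' (fun x hx => (h.inter_subset hx).1.trans w_zero)
      (Set.mapsTo_iff_image_subset.2 (h.image_range rfl).subset) X hX' hr
  · have ne : w 0 ≠ w' 0 := by
      rw [← h.path_zero, ← h.path_last, h.path_injective.ne_iff, Ne, Fin.ext_iff]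
      exact (Nat.mul_pos two_pos hs).ne
    have disjoint : Disjoint (Set.range w) (Set.range w') := Set.disjoint_iff.2 fun x hx =>
      ne ((h.inter_subset hx).1.symm.trans (h.inter_subset hx).2)
    exact isRigid_of_disjoint_cycles h.odd h.left_injective h.right_injective disjoint X hX' hr

section BisectedCycle

variable {l s : ℕ} {w : ZMod (2 * l) → V} {p : Fin (2 * s + 1) → V} {r : ℝ}

lemma IsBisectedCycle.path_apply (h : IsBisectedCycle ρ c w p) (hc : ∀ x, ρ x = x ↔ x = c)
    (hE : Set.MapsTo (Sym2.map ρ) (cycleEdges w ∪ pathEdges p) (cycleEdges w ∪ pathEdges p))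
    (hX : IsBisymmetric ρ (cycleEdges w ∪ pathEdges p) X) (hr : ∀ x, rowSum X x = r) {x y : V}
    (hxy : s(x, y) ∈ pathEdges p) : X x y = r / 2 :=
  hX.path_apply hr hE hc h.path_injective h.path_mid Set.subset_union_right
    (fun _ hx hx0 hxl _ => h.mem_pathEdges hx hx0 hxl) hxy

lemma IsBisectedCycle.alternating (h : IsBisectedCycle ρ c w p)
    (hX : IsBisymmetric ρ (cycleEdges w ∪ pathEdges p) X) (hr : ∀ x, rowSum X x = r)
    {a : ℕ} (ha : a = 0 ∨ a = l) {j : ℕ} (hj : j < l) :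
    X (w (a + j)) (w (a + j + 1)) - r / 2 = (-1) ^ j * (X (w a) (w (a + 1)) - r / 2) := by
  have := h.two_le
  have two_ne : (2 : ZMod (2 * l)) ≠ 0 := fun h2 => by
    have := (h.natCast_inj (i := 2) (j := 0) (by omega) (by omega)).1 (by simp [h2])
    omega
  refine hX.alternating_cycle hr h.cycle_injective two_ne (fun i hi hpos y => ?_) hj
  rw [← Nat.cast_add]
  refine h.mem_cycleEdges ⟨_, rfl⟩ (fun h0 => ?_) (fun hl => ?_)
  · have := (h.natCast_inj (i := a + i) (j := 0) (by omega) (by omega)).1 (by simpa using h0)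
    omega
  · have := (h.natCast_inj (i := a + i) (j := l) (by omega) (by omega)).1 hl
    omega

lemma IsBisectedCycle.apply_pred (h : IsBisectedCycle ρ c w p)
    (hX : IsBisymmetric ρ (cycleEdges w ∪ pathEdges p) X) (hr : ∀ x, rowSum X x = r) :
    X (w (l - 1)) (w l) - r / 2 = (-1) ^ (l - 1) * (X (w 0) (w 1) - r / 2) := by
  have := h.two_le
  have pred := h.alternating hX hr (Or.inl rfl) (j := l - 1) (by omega)
  rwa [Nat.cast_zero, zero_add, zero_add, Nat.cast_pred (by omega), sub_add_cancel] at pred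

lemma IsBisectedCycle.add_eq (h : IsBisectedCycle ρ c w p) (hc : ∀ x, ρ x = x ↔ x = c)
    (hE : Set.MapsTo (Sym2.map ρ) (cycleEdges w ∪ pathEdges p) (cycleEdges w ∪ pathEdges p))
    (hX : IsBisymmetric ρ (cycleEdges w ∪ pathEdges p) X) (hr : ∀ x, rowSum X x = r) :
    X (w (l - 1)) (w l) + X (w l) (w (l + 1)) = r / 2 := by
  classical
  have := h.two_le
  have := h.one_le
  set v := pathVertex p (2 * s - 1)
  have v_last : pathVertex p (2 * s) = w l := (pathVertex_of_lt p (by omega)).trans h.path_last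
  have v_notMem (j : ZMod (2 * l)) : v ≠ w j := fun hj => by
    rcases h.cycle_inter_path.subset ⟨⟨j, hj.symm⟩, ⟨_, rfl⟩⟩ with h0 | hl
    · have := (pathVertex_inj h.path_injective (j := 0) (by omega) (by omega)).1
        (h0.trans h.path_zero.symm)
      omega
    · have := (pathVertex_inj h.path_injective (by omega) le_rfl).1 (hl.trans v_last.symm)
      omega
  have ne : w (l - 1) ≠ w (l + 1) := fun heq => by
    have two_zero : (2 : ℕ) = (0 : ZMod (2 * l)) := by
      push_cast
      linear_combination -h.cycle_injective heq
    have := Nat.le_of_dvd two_pos ((ZMod.natCast_eq_zero_iff _ _).1 two_zero)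
    omega
  have v_apply : X (w l) v = r / 2 := by
    refine h.path_apply hc hE hX hr (mem_pathEdges_iff.2 ⟨2 * s - 1, by omega, ?_⟩)
    rw [Nat.sub_add_cancel (by omega), v_last, Sym2.eq_swap]
  have row := hX.rowSum_apply_eq_sum (x := w l) (S := {v, w (l - 1), w (l + 1)}) fun y hy => by
    rw [Finset.mem_insert, Finset.mem_insert, Finset.mem_singleton]
    refine hy.elim (fun hy => Or.inr (eq_or_eq_of_mem_cycleEdges h.cycle_injective hy)) ?_
    intro hy
    have := eq_or_eq_of_mem_pathEdges h.path_injective le_rfl (v_last.symm ▸ hy)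
    exact Or.inl (this.resolve_right fun hlt => lt_irrefl _ hlt.1).2
  rw [hr, Finset.sum_insert (by simp [v_notMem]), Finset.sum_pair ne, v_apply] at row
  rw [hX.symm (w (l - 1))]
  linarith

lemma IsBisectedCycle.odd (h : IsBisectedCycle ρ c w p) (hρ : Function.Involutive ρ)
    (hc : ∀ x, ρ x = x ↔ x = c)
    (hE : Set.MapsTo (Sym2.map ρ) (cycleEdges w ∪ pathEdges p) (cycleEdges w ∪ pathEdges p))
    (hX : IsBisymmetric ρ (cycleEdges w ∪ pathEdges p) X) (hr : rowSum X = 1) : Odd l := by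
  have := h.two_le
  have hr (x : V) : rowSum X x = 1 := congrFun hr x
  by_contra heven
  have pred := h.apply_pred hX hr
  rw [(Nat.Even.sub_odd (by omega) (Nat.not_odd_iff_even.1 heven) odd_one).neg_one_pow] at pred
  have add_eq := h.add_eq hc hE hX hr
  rw [h.apply_opposite hρ hc hE hX] at add_eq
  linarith

lemma IsBisectedCycle.isRigid (h : IsBisectedCycle ρ c w p) (hρ : Function.Involutive ρ)
    (hc : ∀ x, ρ x = x ↔ x = c)
    (hE : Set.MapsTo (Sym2.map ρ) (cycleEdges w ∪ pathEdges p) (cycleEdges w ∪ pathEdges p))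
    (hl : Odd l) : IsRigid ρ (cycleEdges w ∪ pathEdges p) := by
  intro X hX hr
  have := h.two_le
  have hr (x : V) : rowSum X x = 0 := congrFun hr x
  have opposite := h.apply_opposite hρ hc hE hX
  have first : X (w 0) (w 1) = 0 := by
    have pred := h.apply_pred hX hr
    rw [(Nat.Odd.sub_odd hl odd_one).neg_one_pow] at pred
    have add_eq := h.add_eq hc hE hX hr
    linarith
  have cycle_zero (j : ZMod (2 * l)) : X (w j) (w (j + 1)) = 0 := by
    have : NeZero (2 * l) := ⟨by omega⟩
    rcases lt_or_ge j.val l with hj | hj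
    · simpa [first] using h.alternating hX hr (Or.inl rfl) hj
    · have := ZMod.val_lt j
      simpa [first, opposite, Nat.cast_sub hj] using
        h.alternating hX hr (Or.inr rfl) (j := j.val - l) (by omega)
  refine hX.eq_zero_of_forall_mem fun x y hxy => hxy.elim (hX.apply_of_mem_cycleEdges cycle_zero) ?_
  exact fun hxy => by simpa using h.path_apply hc hE hX hr hxy

end BisectedCycle

end Rigidity

section RowSumSpace

variable {V : Type*} [Fintype V] {ρ : V → V} {E F : Set (Sym2 V)}

/-- The vectors of row sums of the bisymmetric matrices on the edges of `E`. -/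
def rowSumSpace (ρ : V → V) (E : Set (Sym2 V)) : Submodule ℝ (V → ℝ) :=
  (bisymmetric ρ E).map rowSum

lemma rowSumSpace_mono (h : E ⊆ F) : rowSumSpace ρ E ≤ rowSumSpace ρ F :=
  Submodule.map_mono fun _ hX => IsBisymmetric.mono hX h

end RowSumSpace

section OrbitMatrix

variable {V : Type*} [DecidableEq V] {ρ : V → V} {E F : Set (Sym2 V)} {x y : V}

/-- The sum of the indicators of `x` and `ρ x`; at a fixed point of `ρ` it takes the value `2`. -/
def pairVector (ρ : V → V) (x : V) : V → ℝ := Pi.single x 1 + Pi.single (ρ x) 1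

lemma pairVector_map (hρ : Function.Involutive ρ) (x : V) :
    pairVector ρ (ρ x) = pairVector ρ x := by
  rw [pairVector, pairVector, hρ, add_comm]

lemma pairVector_apply_self_pos (ρ : V → V) (x : V) : 0 < pairVector ρ x x := by
  have : (0 : V → ℝ) ≤ Pi.single (ρ x) 1 := Pi.single_nonneg.2 zero_le_one
  simpa [pairVector] using add_pos_of_pos_of_nonneg one_pos (this x)

/-- The sum of the matrix units at `(x, y)`, `(y, x)` and at their images under `ρ`. -/
def orbitMatrix (ρ : V → V) (x y : V) : Matrix V V ℝ :=
  .single x y 1 + .single y x 1 + .single (ρ x) (ρ y) 1 + .single (ρ y) (ρ x) 1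

lemma isBisymmetric_orbitMatrix (hρ : Function.Involutive ρ)
    (hF : Set.MapsTo (Sym2.map ρ) F F) (hxy : s(x, y) ∈ F) :
    IsBisymmetric ρ F (orbitMatrix ρ x y) where
  symm a b := by
    simp only [orbitMatrix, Matrix.add_apply, Matrix.single_apply, and_comm]
    ring
  map a b := by
    simp only [orbitMatrix, Matrix.add_apply, Matrix.single_apply, hρ.injective.eq_iff,
      ← hρ.eq_iff]
    ring
  eq_zero a b hab := by
    have map_mem : s(ρ x, ρ y) ∈ F := hF hxy
    simp only [orbitMatrix, Matrix.add_apply, Matrix.single_apply]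
    rw [if_neg, if_neg, if_neg, if_neg]
    · norm_num
    all_goals rintro ⟨rfl, rfl⟩
    exacts [hab (Sym2.eq_swap ▸ map_mem), hab map_mem, hab (Sym2.eq_swap ▸ hxy), hab hxy]

lemma orbitMatrix_apply_pos (ρ : V → V) (x y : V) : 0 < orbitMatrix ρ x y x y := by
  have single_nonneg (a b : V) : 0 ≤ Matrix.single a b (1 : ℝ) x y := by
    rw [Matrix.single_apply]
    positivity
  have := single_nonneg y x
  have := single_nonneg (ρ x) (ρ y)
  have := single_nonneg (ρ y) (ρ x)
  simp only [orbitMatrix, Matrix.add_apply, Matrix.single_apply_same]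
  linarith

variable [Fintype V]

lemma rowSum_orbitMatrix (ρ : V → V) (x y : V) :
    rowSum (orbitMatrix ρ x y) = pairVector ρ x + pairVector ρ y := by
  have rowSum_single (a b : V) : rowSum (.single a b 1) = Pi.single a 1 := by
    ext i
    simp [rowSum_apply, Matrix.single_apply, Pi.single_apply, ite_and, eq_comm]
  simp only [orbitMatrix, pairVector, map_add, rowSum_single]
  abel

lemma pairVector_add_mem_rowSumSpace (hρ : Function.Involutive ρ)
    (hF : Set.MapsTo (Sym2.map ρ) F F) (hxy : s(x, y) ∈ F) :
    pairVector ρ x + pairVector ρ y ∈ rowSumSpace ρ F :=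
  ⟨_, isBisymmetric_orbitMatrix hρ hF hxy, rowSum_orbitMatrix ρ x y⟩

lemma IsRigid.pairVector_add_notMem (h : IsRigid ρ E) (hρ : Function.Involutive ρ)
    (hE : Set.MapsTo (Sym2.map ρ) E E) (hFE : F ⊆ E) (hxy : s(x, y) ∈ E) (hxyF : s(x, y) ∉ F) :
    pairVector ρ x + pairVector ρ y ∉ rowSumSpace ρ F := by
  rintro ⟨Y, hY : IsBisymmetric ρ F Y, hYr⟩
  have orbit_mem := isBisymmetric_orbitMatrix hρ hE hxy
  have eq_zero : orbitMatrix ρ x y - Y = 0 :=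
    h _ ((bisymmetric ρ E).sub_mem orbit_mem (hY.mono hFE))
      (by rw [map_sub, rowSum_orbitMatrix, hYr, sub_self])
  have apply_zero : orbitMatrix ρ x y x y = 0 := by rw [sub_eq_zero.1 eq_zero, hY.eq_zero x y hxyF]
  exact (orbitMatrix_apply_pos ρ x y).ne' apply_zero

lemma IsRigid.mem_of_pairVector_mem (h : IsRigid ρ E) (hρ : Function.Involutive ρ)
    (hE : Set.MapsTo (Sym2.map ρ) E E) (hFE : F ⊆ E) (hxy : s(x, y) ∈ E)
    (hx : pairVector ρ x ∈ rowSumSpace ρ F) (hy : pairVector ρ y ∈ rowSumSpace ρ F) :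
    s(x, y) ∈ F :=
  by_contra fun hxyF => h.pairVector_add_notMem hρ hE hFE hxy hxyF (add_mem hx hy)

lemma exists_mem_of_pairVector_mem_rowSumSpace (h : pairVector ρ x ∈ rowSumSpace ρ F) :
    ∃ y, s(x, y) ∈ F := by
  obtain ⟨Y, hY : IsBisymmetric ρ F Y, hYr⟩ := h
  by_contra! hx
  have row_zero : rowSum Y x = 0 := by
    rw [rowSum_apply, Finset.sum_eq_zero fun y _ => hY.eq_zero x y (hx y)]
  exact (pairVector_apply_self_pos ρ x).ne' (hYr ▸ row_zero)

lemma pairVector_sub_zpow_smul_mem_rowSumSpace (hρ : Function.Involutive ρ)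
    (hF : Set.MapsTo (Sym2.map ρ) F F) {q : ℤ → V} {i j : ℤ} (hij : i ≤ j)
    (hq : ∀ a ∈ Set.Ico i j, s(q a, q (a + 1)) ∈ F) :
    pairVector ρ (q i) - (-1 : ℝ) ^ (j - i) • pairVector ρ (q j) ∈ rowSumSpace ρ F := by
  induction j, hij using Int.leInduction with
  | base => simp
  | succ j hij ih =>
    have edge := pairVector_add_mem_rowSumSpace hρ hF (hq j ⟨hij, by omega⟩)
    convert add_mem (ih fun a ha => hq a ⟨ha.1, ha.2.trans (lt_add_one j)⟩)
      (Submodule.smul_mem _ ((-1 : ℝ) ^ (j - i)) edge) using 1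
    rw [add_sub_right_comm, zpow_add_one₀ (by norm_num)]
    module

lemma pairVector_mem_rowSumSpace_iff (hρ : Function.Involutive ρ)
    (hF : Set.MapsTo (Sym2.map ρ) F F) {q : ℤ → V} {i j : ℤ} (hij : i ≤ j)
    (hq : ∀ a ∈ Set.Ico i j, s(q a, q (a + 1)) ∈ F) :
    pairVector ρ (q i) ∈ rowSumSpace ρ F ↔ pairVector ρ (q j) ∈ rowSumSpace ρ F := by
  have walk := pairVector_sub_zpow_smul_mem_rowSumSpace hρ hF hij hq
  rw [← Submodule.smul_mem_iff (x := pairVector ρ (q j)) _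
    (zpow_ne_zero (j - i) (show (-1 : ℝ) ≠ 0 by norm_num))]
  exact ⟨fun h => by simpa using sub_mem h walk, fun h => by simpa using add_mem walk h⟩

end OrbitMatrix

section Walks

variable {V : Type*} {ρ : V → V} {E : Set (Sym2 V)} {c : V}

/-- Every vertex has a neighbour, and an edge at a vertex of degree at least two does not end in a
leaf. These are the properties of the loopy graph of a doubly stochastic matrix used to walk along
its edges. -/
structure IsPendantFree (E : Set (Sym2 V)) : Prop where
  exists_mem : ∀ x, ∃ y, s(x, y) ∈ E
  exists_ne : ∀ x y z, s(x, y) ∈ E → s(x, z) ∈ E → z ≠ y → ∃ u ≠ x, s(y, u) ∈ E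

lemma IsPendantFree.exists_walk (hE : IsPendantFree E) {a b z : V} (hab : s(a, b) ∈ E)
    (haz : s(a, z) ∈ E) (hzb : z ≠ b) :
    ∃ v : ℕ → V, v 0 = a ∧ (∀ m, s(v m, v (m + 1)) ∈ E) ∧ ∀ m, v (m + 2) ≠ v m := by
  let Step := {d : V × V // s(d.1, d.2) ∈ E ∧ ∃ z ≠ d.2, s(d.1, z) ∈ E}
  have exists_next (d : Step) : ∃ d' : Step, d'.1.1 = d.1.2 ∧ d'.1.2 ≠ d.1.1 := by
    obtain ⟨⟨x, y⟩, hxy, z, hzy, hxz⟩ := d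
    obtain ⟨u, hux, hyu⟩ := hE.exists_ne x y z hxy hxz hzy
    exact ⟨⟨(y, u), hyu, x, hux.symm, Sym2.eq_swap ▸ hxy⟩, rfl, hux⟩
  choose next next_fst next_snd using exists_next
  let d (m : ℕ) : Step := next^[m] ⟨(a, b), hab, z, hzb, haz⟩
  have d_succ (m : ℕ) : d (m + 1) = next (d m) := Function.iterate_succ_apply' ..
  have fst_succ (m : ℕ) : (d (m + 1)).1.1 = (d m).1.2 := by rw [d_succ, next_fst]
  refine ⟨fun m => (d m).1.1, rfl, fun m => ?_, fun m => ?_⟩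
  · simpa only [fst_succ] using (d m).2.1
  · simpa only [fst_succ, d_succ m] using next_snd (d m)

/-- The edges that the walk `q` uses between the times `a` and `a + 1` for `a ∈ I`. -/
def walkEdges (q : ℤ → V) (I : Set ℤ) : Set (Sym2 V) := (fun a => s(q a, q (a + 1))) '' I

/-- The two-sided walk that follows `v` for positive times and its mirror image for negative
ones. -/
def symmetricWalk (ρ : V → V) (v : ℕ → V) (a : ℤ) : V :=
  if 0 ≤ a then v a.natAbs else ρ (v a.natAbs)

lemma map_symmetricWalk (hρ : Function.Involutive ρ) {v : ℕ → V} (h0 : ρ (v 0) = v 0) (a : ℤ) :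
    ρ (symmetricWalk ρ v a) = symmetricWalk ρ v (-a) := by
  rcases lt_trichotomy a 0 with ha | rfl | ha
  · simp [symmetricWalk, ha.not_ge, ha.le, hρ _]
  · simp [symmetricWalk, h0]
  · simp [symmetricWalk, ha.le, ha.not_ge]

lemma symmetricWalk_natCast (v : ℕ → V) (m : ℕ) : symmetricWalk ρ v m = v m := by
  simp [symmetricWalk]

lemma eq_or_eq_of_symmetricWalk_eq (hρ : Function.Involutive ρ) {v : ℕ → V} {a b : ℤ}
    (h : symmetricWalk ρ v a = symmetricWalk ρ v b) :
    v a.natAbs = v b.natAbs ∨ v a.natAbs = ρ (v b.natAbs) := by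
  unfold symmetricWalk at h
  split_ifs at h
  exacts [Or.inl h, Or.inr h, Or.inr (by rw [← h, hρ]), Or.inl (hρ.injective h)]

lemma mk_symmetricWalk_mem (hρ : Function.Involutive ρ) (hE : Set.MapsTo (Sym2.map ρ) E E)
    {v : ℕ → V} (h0 : ρ (v 0) = v 0) (hv : ∀ m, s(v m, v (m + 1)) ∈ E) (a : ℤ) :
    s(symmetricWalk ρ v a, symmetricWalk ρ v (a + 1)) ∈ E := by
  have nonneg_mem (m : ℕ) : s(symmetricWalk ρ v m, symmetricWalk ρ v (m + 1)) ∈ E := by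
    exact_mod_cast hv m
  rcases le_or_gt 0 a with ha | ha
  · lift a to ℕ using ha
    exact nonneg_mem a
  · obtain ⟨m, hm⟩ := Int.eq_ofNat_of_zero_le (show 0 ≤ -(a + 1) by omega)
    have := hE (nonneg_mem m)
    rw [Sym2.map_mk, map_symmetricWalk hρ h0, map_symmetricWalk hρ h0, Sym2.eq_swap] at this
    rwa [show a = -(m + 1 : ℤ) by omega, show -(m + 1 : ℤ) + 1 = -m by omega]

/-- A walk `q` with `ρ (q a) = q (-a)` that visits distinct vertices up to time `t`, when it returns
to its vertex at time `i` or at time `-i`. -/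
structure IsSymmetricLollipop (ρ : V → V) (q : ℤ → V) (i t : ℤ) : Prop where
  nonneg : 0 ≤ i
  lt : i < t
  map_apply : ∀ a, ρ (q a) = q (-a)
  injOn : Set.InjOn q (Set.Ioo (-t) t)
  close : q t = q i ∨ q t = q (-i)
  ne : t = i + 2 → q t ≠ q i

lemma exists_isSymmetricLollipop_symmetricWalk [Finite V] (hρ : Function.Involutive ρ) {v : ℕ → V}
    (h0 : ∀ x, ρ x = x ↔ x = v 0) (hne : ∀ m, v (m + 2) ≠ v m) :
    ∃ i t, IsSymmetricLollipop ρ (symmetricWalk ρ v) i t := by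
  classical
  have map_walk (a : ℤ) : ρ (symmetricWalk ρ v a) = symmetricWalk ρ v (-a) :=
    map_symmetricWalk hρ ((h0 _).2 rfl) a
  have exists_return : ∃ t, ∃ i < t, v t = v i ∨ v t = ρ (v i) := by
    obtain ⟨i, j, hij, h⟩ := Finite.exists_ne_map_eq_of_infinite v
    rcases hij.lt_or_gt with hlt | hlt
    exacts [⟨j, i, hlt, Or.inl h.symm⟩, ⟨i, j, hlt, Or.inl h⟩]
  set t := Nat.find exists_return
  obtain ⟨i, hit, return_eq⟩ := Nat.find_spec exists_return
  have eq_of_return {a b : ℕ} (ha : a < t) (hb : b < t) (h : v a = v b ∨ v a = ρ (v b)) :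
      a = b := by
    by_contra hab
    rcases Ne.lt_or_gt hab with hlt | hlt
    · refine Nat.find_min exists_return hb ⟨a, hlt, h.imp Eq.symm fun h => ?_⟩
      rw [h, hρ]
    · exact Nat.find_min exists_return ha ⟨b, hlt, h⟩
  have natAbs_eq {a b : ℤ} (ha : a ∈ Set.Ioo (-t : ℤ) t) (hb : b ∈ Set.Ioo (-t : ℤ) t)
      (h : symmetricWalk ρ v a = symmetricWalk ρ v b) : a.natAbs = b.natAbs :=
    eq_of_return (by grind) (by grind) (eq_or_eq_of_symmetricWalk_eq hρ h)
  refine ⟨i, t, by positivity, by exact_mod_cast hit, map_walk, ?_, ?_, ?_⟩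
  · intro a ha b hb hab
    rcases Int.natAbs_eq_natAbs_iff.1 (natAbs_eq ha hb hab) with rfl | rfl
    · rfl
    · rw [← map_walk, h0] at hab
      have : b.natAbs = 0 := natAbs_eq hb (b := 0) (by grind)
        (hab.trans (symmetricWalk_natCast v 0).symm)
      omega
  · rw [← map_walk, symmetricWalk_natCast, symmetricWalk_natCast]
    exact return_eq
  · intro hti
    have hti : t = i + 2 := by omega
    rw [symmetricWalk_natCast, symmetricWalk_natCast, hti]
    exact hne i

lemma IsPendantFree.exists_isSymmetricLollipop [Finite V] (hE : IsPendantFree E)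
    (hρ : Function.Involutive ρ) (hc : ∀ x, ρ x = x ↔ x = c)
    (hEρ : Set.MapsTo (Sym2.map ρ) E E) :
    ∃ q i t, IsSymmetricLollipop ρ q i t ∧ q 0 = c ∧ walkEdges q (Set.Ico (-t) t) ⊆ E := by
  obtain ⟨b, hcb⟩ := hE.exists_mem c
  have map_c : ρ c = c := (hc c).2 rfl
  by_cases hb : b = c
  · refine ⟨fun _ => c, 0, 1, ⟨le_rfl, one_pos, by simp [map_c], ?_, by simp, by simp⟩, rfl, ?_⟩
    · intro a ha b hb _
      grind
    · rintro _ ⟨a, -, rfl⟩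
      exact hb ▸ hcb
  · have hcb' : s(c, ρ b) ∈ E := by simpa [map_c] using hEρ hcb
    obtain ⟨v, rfl, hv, hne⟩ := hE.exists_walk hcb hcb' (mt (hc b).1 hb)
    obtain ⟨i, t, h⟩ := exists_isSymmetricLollipop_symmetricWalk hρ hc hne
    refine ⟨symmetricWalk ρ v, i, t, h, symmetricWalk_natCast v 0, ?_⟩
    rintro _ ⟨a, -, rfl⟩
    exact mk_symmetricWalk_mem hρ hEρ map_c hv a

end Walks

section Lollipop

variable {V : Type*} {ρ : V → V} {E : Set (Sym2 V)} {q : ℤ → V} {i t : ℤ}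

lemma mapsTo_walkEdges (hq : ∀ a, ρ (q a) = q (-a)) {I : Set ℤ} (hI : ∀ a ∈ I, -(a + 1) ∈ I) :
    Set.MapsTo (Sym2.map ρ) (walkEdges q I) (walkEdges q I) := by
  rintro _ ⟨a, ha, rfl⟩
  refine ⟨-(a + 1), hI a ha, ?_⟩
  rw [Sym2.map_mk, hq, hq, Sym2.eq_swap, show -a = -(a + 1) + 1 by ring]

namespace IsSymmetricLollipop

lemma last_mem (h : IsSymmetricLollipop ρ q i t) : q t ∈ q '' Set.Ioo (-t) t := by
  have := h.nonneg
  have := h.lt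
  rcases h.close with hclose | hclose
  · exact ⟨i, by grind, hclose.symm⟩
  · exact ⟨-i, by grind, hclose.symm⟩

lemma mapsTo (h : IsSymmetricLollipop ρ q i t) :
    Set.MapsTo ρ (q '' Set.Ioo (-t) t) (q '' Set.Ioo (-t) t) := by
  rintro _ ⟨a, ha, rfl⟩
  exact ⟨-a, by grind, (h.map_apply a).symm⟩

lemma walkEdges_subset_sym2 (h : IsSymmetricLollipop ρ q i t) :
    walkEdges q (Set.Ico (-t) t) ⊆ (q '' Set.Ioo (-t) t).sym2 := by
  have mem_of_le {a : ℤ} (ha : -t ≤ a) (hat : a ≤ t) : q a ∈ q '' Set.Ioo (-t) t := by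
    rcases ha.eq_or_lt with rfl | ha
    · exact h.map_apply t ▸ h.mapsTo h.last_mem
    · rcases hat.eq_or_lt with rfl | hat
      exacts [h.last_mem, ⟨a, ⟨ha, hat⟩, rfl⟩]
  rintro _ ⟨a, ⟨ha, hat⟩, rfl⟩
  exact ⟨mem_of_le ha hat.le, mem_of_le (by omega) hat⟩

lemma edge_notMem (h : IsSymmetricLollipop ρ q i t) (hit : i + 2 ≤ t) :
    s(q i, q (i + 1)) ∉ walkEdges q (Set.Ico (i + 1) t ∪ Set.Ico (-t) (-(i + 1))) := by
  have := h.nonneg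
  have inj {a b : ℤ} (ha : a ∈ Set.Ioo (-t) t) (hb : b ∈ Set.Ioo (-t) t) (hab : q a = q b) :
      a = b := h.injOn ha hb hab
  rintro ⟨a, ha | ha, heq⟩
  · rcases Sym2.eq_iff.1 heq with ⟨h1, -⟩ | ⟨h1, h2⟩
    · have := inj (by grind) (by grind) h1
      grind
    · obtain rfl := inj (by grind) (by grind) h1
      rw [add_assoc] at h2
      rcases hit.eq_or_lt with hit | hit
      · exact h.ne hit.symm (hit ▸ h2)
      · have := inj (by grind) (by grind) h2
        omega
  · rcases Sym2.eq_iff.1 heq with ⟨-, h1⟩ | ⟨-, h1⟩ <;>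
    · have := inj (by grind) (by grind) h1
      grind

lemma pairVector_last [DecidableEq V] (h : IsSymmetricLollipop ρ q i t)
    (hρ : Function.Involutive ρ) : pairVector ρ (q t) = pairVector ρ (q i) := by
  rcases h.close with hclose | hclose
  · rw [hclose]
  · rw [hclose, ← h.map_apply, pairVector_map hρ]

end IsSymmetricLollipop

end Lollipop

section EdgeInsertion

variable {V : Type*} {ρ : V → V} {E : Set (Sym2 V)} {W : Set V}

lemma insert_edges_subset (hEρ : Set.MapsTo (Sym2.map ρ) E E) (hWρ : Set.MapsTo ρ W W) {x y : V}
    (hx : x ∈ W) (hxy : s(x, y) ∈ E) :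
    E ∩ W.sym2 ∪ {s(x, y), s(ρ x, ρ y)} ⊆ E ∩ (W ∪ {y, ρ y}).sym2 := by
  rintro e (he | rfl | rfl)
  · induction e with
    | _ a b => exact ⟨he.1, Or.inl he.2.1, Or.inl he.2.2⟩
  · exact ⟨hxy, Or.inl hx, Or.inr (Or.inl rfl)⟩
  · exact ⟨hEρ hxy, Or.inl (hWρ hx), Or.inr (Or.inr rfl)⟩

end EdgeInsertion

section LollipopSpan

variable {V : Type*} [Fintype V] {ρ : V → V} {E : Set (Sym2 V)} {q : ℤ → V} {i t : ℤ}

namespace IsSymmetricLollipop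

/- If `t - i` were even, the alternating sum of the orbit matrices along the walk from time `i + 1`
to time `t` would have the same row sums as the orbit matrix of the edge `{q i, q (i + 1)}`. -/
lemma odd (h : IsSymmetricLollipop ρ q i t) (hE : IsRigid ρ E) (hρ : Function.Involutive ρ)
    (hEρ : Set.MapsTo (Sym2.map ρ) E E) (hq : walkEdges q (Set.Ico (-t) t) ⊆ E) :
    Odd (t - i) := by
  classical
  have := h.nonneg
  have := h.lt
  by_contra heven
  have hit : i + 2 ≤ t := by
    by_contra! hlt
    exact heven ⟨0, by omega⟩
  set I := Set.Ico (i + 1) t ∪ Set.Ico (-t) (-(i + 1))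
  have walkEdges_subset : walkEdges q I ⊆ E :=
    (Set.image_mono (by grind)).trans hq
  have edge_mem : s(q i, q (i + 1)) ∈ E := hq ⟨i, by grind, rfl⟩
  have walk := pairVector_sub_zpow_smul_mem_rowSumSpace hρ
    (mapsTo_walkEdges (I := I) h.map_apply (by grind)) (q := q) (i := i + 1) (j := t) (by omega)
    fun a ha => ⟨a, Or.inl ha, rfl⟩
  have odd_sub : Odd (t - (i + 1)) := by
    rw [← sub_sub]
    exact (Int.not_odd_iff_even.1 heven).sub_odd odd_one
  rw [odd_sub.neg_one_zpow, neg_one_smul, sub_neg_eq_add, h.pairVector_last hρ, add_comm] at walk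
  exact hE.pairVector_add_notMem hρ hEρ walkEdges_subset edge_mem (h.edge_notMem hit) walk

lemma pairVector_mem [DecidableEq V] (h : IsSymmetricLollipop ρ q i t) (hρ : Function.Involutive ρ)
    (hodd : Odd (t - i)) {x : V} (hx : x ∈ q '' Set.Ioo (-t) t) :
    pairVector ρ x ∈ rowSumSpace ρ (walkEdges q (Set.Ico (-t) t)) := by
  have := h.nonneg
  have := h.lt
  have edges_mapsTo := mapsTo_walkEdges (I := Set.Ico (-t) t) h.map_apply (by grind)
  have walk_mem (a : ℤ) (ha : a ∈ Set.Ico (-t) t) :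
      s(q a, q (a + 1)) ∈ walkEdges q (Set.Ico (-t) t) := ⟨a, ha, rfl⟩
  have base_mem : pairVector ρ (q i) ∈ rowSumSpace ρ (walkEdges q (Set.Ico (-t) t)) := by
    have closed_walk := pairVector_sub_zpow_smul_mem_rowSumSpace hρ edges_mapsTo h.lt.le
      fun a ha => walk_mem a (by grind)
    rw [hodd.neg_one_zpow, h.pairVector_last hρ, neg_one_smul, sub_neg_eq_add, ← two_smul ℝ,
      Submodule.smul_mem_iff _ two_ne_zero] at closed_walk
    exact closed_walk
  obtain ⟨a, ha, rfl⟩ := hx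
  rcases le_total a i with hai | hia
  · exact (pairVector_mem_rowSumSpace_iff hρ edges_mapsTo hai
      fun b hb => walk_mem b (by grind)).2 base_mem
  · exact (pairVector_mem_rowSumSpace_iff hρ edges_mapsTo hia
      fun b hb => walk_mem b (by grind)).1 base_mem

lemma mem_walkEdges_iff (h : IsSymmetricLollipop ρ q i t) (hE : IsRigid ρ E)
    (hρ : Function.Involutive ρ) (hEρ : Set.MapsTo (Sym2.map ρ) E E)
    (hq : walkEdges q (Set.Ico (-t) t) ⊆ E) {x y : V} :
    s(x, y) ∈ walkEdges q (Set.Ico (-t) t) ↔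
      s(x, y) ∈ E ∧ x ∈ q '' Set.Ioo (-t) t ∧ y ∈ q '' Set.Ioo (-t) t := by
  classical
  have hodd := h.odd hE hρ hEρ hq
  constructor
  · exact fun hxy => ⟨hq hxy, h.walkEdges_subset_sym2 hxy⟩
  · rintro ⟨hxy, hx, hy⟩
    exact hE.mem_of_pairVector_mem hρ hEρ hq hxy (h.pairVector_mem hρ hodd hx)
      (h.pairVector_mem hρ hodd hy)

end IsSymmetricLollipop

end LollipopSpan

section Growth

variable {V : Type*} [Fintype V] [DecidableEq V] {ρ : V → V} {E : Set (Sym2 V)} {W : Set V}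

/-- A `ρ`-invariant vertex set `W` such that the edges of `E` inside `W` realize every `pairVector`
of a vertex of `W` as a vector of row sums. If `E` is rigid, edges added inside `W` would be
redundant; this is used to show that no edge leaves `W`. -/
structure IsSpanned (ρ : V → V) (E : Set (Sym2 V)) (W : Set V) : Prop where
  mapsTo : Set.MapsTo ρ W W
  pairVector_mem : ∀ x ∈ W, pairVector ρ x ∈ rowSumSpace ρ (E ∩ W.sym2)

lemma IsSymmetricLollipop.isSpanned {q : ℤ → V} {i t : ℤ} (h : IsSymmetricLollipop ρ q i t)
    (hρ : Function.Involutive ρ) (hodd : Odd (t - i)) (hq : walkEdges q (Set.Ico (-t) t) ⊆ E) :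
    IsSpanned ρ E (q '' Set.Ioo (-t) t) where
  mapsTo := h.mapsTo
  pairVector_mem _ hx := rowSumSpace_mono (Set.subset_inter hq h.walkEdges_subset_sym2)
    (h.pairVector_mem hρ hodd hx)

lemma IsSpanned.pairVector_mem_insert (hW : IsSpanned ρ E W) (hρ : Function.Involutive ρ) {x y : V}
    (hx : x ∈ W) {z : V} (hz : z ∈ W ∪ {y, ρ y}) :
    pairVector ρ z ∈ rowSumSpace ρ (E ∩ W.sym2 ∪ {s(x, y), s(ρ x, ρ y)}) := by
  have old_mem {z : V} (hz : z ∈ W) :=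
    rowSumSpace_mono (F := E ∩ W.sym2 ∪ {s(x, y), s(ρ x, ρ y)}) Set.subset_union_left
      (hW.pairVector_mem z hz)
  have new_edge_mem : pairVector ρ x + pairVector ρ y ∈
      rowSumSpace ρ (E ∩ W.sym2 ∪ {s(x, y), s(ρ x, ρ y)}) := by
    refine rowSumSpace_mono Set.subset_union_right
      (pairVector_add_mem_rowSumSpace hρ (F := {s(x, y), s(ρ x, ρ y)}) ?_ (Or.inl rfl))
    rintro _ (rfl | rfl)
    · exact Or.inr rfl
    · exact Or.inl (by rw [Sym2.map_mk, hρ, hρ])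
  have y_mem := (Submodule.add_mem_iff_right _ (old_mem hx)).1 new_edge_mem
  rcases hz with hz | rfl | rfl
  · exact old_mem hz
  · exact y_mem
  · rwa [pairVector_map hρ]

lemma IsSpanned.insert (hW : IsSpanned ρ E W) (hρ : Function.Involutive ρ)
    (hEρ : Set.MapsTo (Sym2.map ρ) E E) {x y : V} (hx : x ∈ W) (hxy : s(x, y) ∈ E) :
    IsSpanned ρ E (W ∪ {y, ρ y}) where
  mapsTo := by
    rintro _ (hz | rfl | rfl)
    exacts [Or.inl (hW.mapsTo hz), Or.inr (Or.inr rfl), Or.inr (Or.inl (hρ _))]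
  pairVector_mem _ hz := rowSumSpace_mono (insert_edges_subset hEρ hW.mapsTo hx hxy)
    (hW.pairVector_mem_insert hρ hx hz)

lemma IsSpanned.exists_edge_leaving_insert (hW : IsSpanned ρ E W) (hE : IsRigid ρ E)
    (hpend : IsPendantFree E) (hρ : Function.Involutive ρ) (hEρ : Set.MapsTo (Sym2.map ρ) E E)
    (hfix : ∀ x, ρ x = x → x ∈ W) {x y : V} (hx : x ∈ W) (hy : y ∉ W) (hxy : s(x, y) ∈ E) :
    ∃ u, u ∉ W ∪ {y, ρ y} ∧ s(y, u) ∈ E := by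
  obtain ⟨z, hxz, -, hz⟩ := exists_mem_of_pairVector_mem_rowSumSpace (hW.pairVector_mem x hx)
  obtain ⟨u, hux, hyu⟩ := hpend.exists_ne x y z hxy hxz (ne_of_mem_of_not_mem hz hy)
  refine ⟨u, fun hu => ?_, hyu⟩
  rcases hE.mem_of_pairVector_mem hρ hEρ
    ((insert_edges_subset hEρ hW.mapsTo hx hxy).trans Set.inter_subset_left) hyu
    (hW.pairVector_mem_insert hρ hx (Or.inr (Or.inl rfl))) (hW.pairVector_mem_insert hρ hx hu)
    with hin | heq | heq
  · exact hy hin.2.1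
  · rcases Sym2.eq_iff.1 heq with ⟨rfl, -⟩ | ⟨-, rfl⟩
    exacts [hy hx, hux rfl]
  · rcases Sym2.eq_iff.1 heq with ⟨rfl, -⟩ | ⟨h, -⟩
    exacts [hy (hW.mapsTo hx), hy (hfix y h.symm)]

/- A spanned set with a leaving edge has a larger spanned set with a leaving edge, which cannot go
on forever. -/
lemma IsSpanned.mem_of_mem (hW : IsSpanned ρ E W) (hE : IsRigid ρ E) (hpend : IsPendantFree E)
    (hρ : Function.Involutive ρ) (hEρ : Set.MapsTo (Sym2.map ρ) E E)
    (hfix : ∀ x, ρ x = x → x ∈ W) {x y : V} (hx : x ∈ W) (hxy : s(x, y) ∈ E) : y ∈ W := by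
  induction W using WellFoundedGT.induction generalizing x y with
  | ind W ih =>
    by_contra hy
    obtain ⟨u, hu, hyu⟩ := hW.exists_edge_leaving_insert hE hpend hρ hEρ hfix hx hy hxy
    have y_mem : y ∈ W ∪ {y, ρ y} := Or.inr (Or.inl rfl)
    refine hu (ih _ (Set.ssubset_iff_exists.2 ⟨Set.subset_union_left, y, y_mem, hy⟩)
      (hW.insert hρ hEρ hx hxy) (fun x hx => Or.inl (hfix x hx)) y_mem hyu)

end Growth

section CyclesFromWalks

variable {V : Type*} {q : ℤ → V} {a : ℤ} {k s : ℕ}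

/-- The vertices `q a, …, q (a + k - 1)` of a walk, indexed cyclically. -/
def closedWalk (q : ℤ → V) (a : ℤ) (k : ℕ) (j : ZMod k) : V := q (a + j.val)

/-- The vertices `q s, …, q (-s)` of a walk, which traverse it backwards. -/
def centeredPath (q : ℤ → V) (s : ℕ) (j : Fin (2 * s + 1)) : V := q (s - j)

lemma closedWalk_natCast (hq : q (a + k) = q a) {j : ℕ} (hj : j ≤ k) :
    closedWalk q a k j = q (a + j) := by
  rcases hj.eq_or_lt with rfl | hj
  · simp [closedWalk, hq]
  · rw [closedWalk, ZMod.val_natCast_of_lt hj]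

lemma image_closedWalk_Icc (hq : q (a + k) = q a) {m m' : ℕ} (hm' : m' ≤ k) :
    (fun j : ℕ => closedWalk q a k j) '' Set.Icc m m' = q '' Set.Icc (a + m) (a + m') := by
  ext x
  constructor
  · rintro ⟨j, hj, rfl⟩
    exact ⟨a + j, by grind, (closedWalk_natCast hq (hj.2.trans hm')).symm⟩
  · rintro ⟨b, hb, rfl⟩
    obtain ⟨j, hj⟩ := Int.eq_ofNat_of_zero_le (show 0 ≤ b - a by grind)
    obtain rfl : b = a + j := by omega
    exact ⟨j, by grind, closedWalk_natCast hq (by grind)⟩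

lemma range_centeredPath : Set.range (centeredPath q s) = q '' Set.Icc (-s : ℤ) s := by
  ext x
  constructor
  · rintro ⟨j, rfl⟩
    exact ⟨s - j, by grind, rfl⟩
  · rintro ⟨b, hb, rfl⟩
    obtain ⟨j, hj⟩ := Int.eq_ofNat_of_zero_le (show 0 ≤ s - b by grind)
    exact ⟨⟨j, by grind⟩, congrArg q (show (s : ℤ) - j = b by omega)⟩

lemma centeredPath_injective (hq : Set.InjOn q (Set.Icc (-s : ℤ) s)) :
    Function.Injective (centeredPath q s) := fun j j' h => by
  have := hq (by grind) (by grind) h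
  omega

lemma pathEdges_centeredPath :
    pathEdges (centeredPath q s) = walkEdges q (Set.Ico (-s : ℤ) s) := by
  have edge_eq (j b : ℤ) (h : j + b + 1 = s) :
      s(q (s - j), q (s - (j + 1))) = s(q b, q (b + 1)) := by
    rw [Sym2.eq_swap, show s - (j + 1) = b by omega, show s - j = b + 1 by omega]
  ext e
  constructor
  · rintro ⟨j, rfl⟩
    exact ⟨s - j - 1, by grind, (edge_eq j _ (by ring)).symm⟩
  · rintro ⟨b, hb, rfl⟩
    obtain ⟨j, hj⟩ := Int.eq_ofNat_of_zero_le (show 0 ≤ s - b - 1 by grind)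
    exact ⟨⟨j, by grind⟩, edge_eq j b (by omega)⟩

variable [NeZero k]

lemma range_add_val : Set.range (fun j : ZMod k => a + (j.val : ℤ)) = Set.Ico a (a + k) := by
  ext b
  constructor
  · rintro ⟨j, rfl⟩
    have := ZMod.val_lt j
    grind
  · intro hb
    obtain ⟨j, hj⟩ := Int.eq_ofNat_of_zero_le (show 0 ≤ b - a by grind)
    refine ⟨j, show a + ((j : ZMod k).val : ℤ) = b from ?_⟩
    rw [ZMod.val_natCast_of_lt (show j < k by grind)]
    omega

lemma closedWalk_injective (hq : Set.InjOn q (Set.Ico a (a + k))) :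
    Function.Injective (closedWalk q a k) := fun j j' h => by
  have mem_Ico (j : ZMod k) : a + (j.val : ℤ) ∈ Set.Ico a (a + k) :=
    range_add_val.subset ⟨j, rfl⟩
  exact ZMod.val_injective k (by exact_mod_cast add_left_cancel (hq (mem_Ico j) (mem_Ico j') h))

lemma range_closedWalk : Set.range (closedWalk q a k) = q '' Set.Ico a (a + k) := by
  rw [← range_add_val, ← Set.range_comp]
  rfl

lemma closedWalk_add_one (hq : q (a + k) = q a) (j : ZMod k) :
    closedWalk q a k (j + 1) = q (a + j.val + 1) := by
  have := closedWalk_natCast hq (Nat.succ_le_of_lt (ZMod.val_lt j))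
  rwa [Nat.cast_succ, ZMod.natCast_zmod_val, Nat.cast_succ, ← add_assoc] at this

lemma cycleEdges_closedWalk (hq : q (a + k) = q a) :
    cycleEdges (closedWalk q a k) = walkEdges q (Set.Ico a (a + k)) := by
  rw [walkEdges, ← range_add_val, ← Set.range_comp]
  exact congrArg Set.range (funext fun j => by rw [closedWalk_add_one hq]; rfl)

end CyclesFromWalks

section LollipopShapes

variable {V : Type*} {ρ : V → V} {q : ℤ → V} {s k : ℕ}

lemma image_neg_Ico (q : ℤ → V) (i t : ℤ) :
    (fun a => q (-a)) '' Set.Ico i t = q '' Set.Ioc (-t) (-i) := by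
  rw [← Set.neg_Ico, ← Set.image_neg_eq_neg, Set.image_image]

lemma walkEdges_neg (q : ℤ → V) (i t : ℤ) :
    walkEdges (fun a => q (-a)) (Set.Ico i t) = walkEdges q (Set.Ico (-t) (-i)) := by
  have edge_eq (a b : ℤ) (h : a + b + 1 = 0) :
      s(q (-a), q (-(a + 1))) = s(q b, q (b + 1)) := by
    rw [Sym2.eq_swap, show -(a + 1) = b by omega, show -a = b + 1 by omega]
  ext e
  constructor
  · rintro ⟨a, ha, rfl⟩
    exact ⟨-a - 1, by grind, (edge_eq a _ (by ring)).symm⟩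
  · rintro ⟨b, hb, rfl⟩
    exact ⟨-b - 1, by grind, edge_eq _ b (by ring)⟩

/-- The walk that follows `q` up to time `t` and jumps to time `-i` there, from where it follows `q`
backwards. It goes around the cycle formed by the two halves of a symmetric lollipop with
`q t = q (-i)`. -/
def gluedWalk (q : ℤ → V) (i t a : ℤ) : V := if a < t then q a else q (t - i - a)

lemma image_gluedWalk_Icc {i t : ℤ} (hclose : q t = q (-i)) :
    gluedWalk q i t '' Set.Icc i t = q '' Set.Icc i t := by
  refine Set.image_congr fun a ha => ?_
  rcases ha.2.lt_or_eq with hlt | rfl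
  · exact if_pos hlt
  · rw [gluedWalk, if_neg (lt_irrefl _), hclose]
    ring_nf

lemma image_gluedWalk_Icc_right {i t : ℤ} :
    gluedWalk q i t '' Set.Icc t (2 * t - i) = q '' Set.Icc (-t) (-i) := by
  ext x
  constructor
  · rintro ⟨a, ha, rfl⟩
    exact ⟨t - i - a, by grind, by rw [gluedWalk, if_neg ha.1.not_gt]⟩
  · rintro ⟨b, hb, rfl⟩
    refine ⟨t - i - b, by grind, ?_⟩
    rw [gluedWalk, if_neg (by grind), sub_sub_cancel]

lemma image_gluedWalk_Ico {i t : ℤ} :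
    gluedWalk q i t '' Set.Ico i (2 * t - i) = q '' (Set.Ico i t ∪ Set.Ioc (-t) (-i)) := by
  ext x
  constructor
  · rintro ⟨a, ha, rfl⟩
    unfold gluedWalk
    split_ifs
    · exact ⟨a, by grind, rfl⟩
    · exact ⟨t - i - a, by grind, rfl⟩
  · rintro ⟨b, hb | hb, rfl⟩
    · exact ⟨b, by grind, if_pos hb.2⟩
    · refine ⟨t - i - b, by grind, ?_⟩
      rw [gluedWalk, if_neg (by grind), sub_sub_cancel]

lemma walkEdges_gluedWalk {i t : ℤ} (hclose : q t = q (-i)) :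
    walkEdges (gluedWalk q i t) (Set.Ico i (2 * t - i)) =
      walkEdges q (Set.Ico i t) ∪ walkEdges q (Set.Ico (-t) (-i)) := by
  have edge_left {a : ℤ} (ha : a < t) :
      s(gluedWalk q i t a, gluedWalk q i t (a + 1)) = s(q a, q (a + 1)) := by
    rcases (Int.add_one_le_of_lt ha).lt_or_eq with hlt | heq
    · rw [gluedWalk, gluedWalk, if_pos ha, if_pos hlt]
    · rw [gluedWalk, gluedWalk, if_pos ha, if_neg heq.not_lt, heq, hclose]
      ring_nf
  have edge_right {a b : ℤ} (ha : t ≤ a) (hab : a + b + 1 = t - i) :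
      s(gluedWalk q i t a, gluedWalk q i t (a + 1)) = s(q b, q (b + 1)) := by
    rw [gluedWalk, gluedWalk, if_neg (by omega), if_neg (by omega), Sym2.eq_swap,
      show t - i - (a + 1) = b by omega, show t - i - a = b + 1 by omega]
  ext e
  constructor
  · rintro ⟨a, ha, rfl⟩
    rcases lt_or_ge a t with hlt | hge
    · exact Or.inl ⟨a, by grind, (edge_left hlt).symm⟩
    · exact Or.inr ⟨t - i - a - 1, by grind, (edge_right hge (by ring)).symm⟩
  · rintro (⟨a, ha, rfl⟩ | ⟨b, hb, rfl⟩)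
    · exact ⟨a, by grind, edge_left ha.2⟩
    · exact ⟨t - i - b - 1, by grind, edge_right (by grind) (by ring)⟩

namespace IsSymmetricLollipop

lemma apply_neg_last {i t : ℤ} (h : IsSymmetricLollipop ρ q i t) (hclose : q t = q (-i)) :
    q (-t) = q i := by
  rw [← h.map_apply, hclose, h.map_apply, neg_neg]

lemma walkEdges_eq_of_close_neg {i t : ℤ} (h : IsSymmetricLollipop ρ q i t) (hti : t = i + 1)
    (hclose : q t = q (-i)) :
    walkEdges q (Set.Ico (-i) t) = walkEdges q (Set.Ico (-t) t) := by
  have := h.nonneg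
  have first_eq_last : s(q (-t), q (-t + 1)) = s(q i, q (i + 1)) := by
    rw [h.apply_neg_last hclose, ← hti, hclose, hti]
    ring_nf
  have insert_first : Set.Ico (-t) t = insert (-t) (Set.Ico (-i) t) := by grind
  rw [insert_first, walkEdges, walkEdges, Set.image_insert_eq, first_eq_last,
    Set.insert_eq_of_mem (Set.mem_image_of_mem (fun a => s(q a, q (a + 1)))
      (show i ∈ Set.Ico (-i) t by grind))]

lemma image_inter_image {i t : ℤ} (h : IsSymmetricLollipop ρ q i t) {I J K : Set ℤ}
    (hIJ : I ∪ J ⊆ Set.Ioo (-t) t) (hK : I ∩ J = K) : q '' I ∩ q '' J = q '' K := by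
  rw [← h.injOn.image_inter (Set.subset_union_left.trans hIJ)
    (Set.subset_union_right.trans hIJ), hK]

lemma isDumbbell (h : IsSymmetricLollipop ρ q s (s + k)) (hk : Odd k) (hsk : 2 ≤ s + k) :
    IsDumbbell ρ (q 0) (closedWalk q s k) (closedWalk (fun a => q (-a)) s k)
      (centeredPath q s) := by
  have : NeZero k := ⟨hk.pos.ne'⟩
  have kpos := hk.pos
  have range_left : Set.range (closedWalk q s k) = q '' Set.Ico s (s + k) := range_closedWalk
  have range_right : Set.range (closedWalk (fun a => q (-a)) s k) =
      q '' Set.Ioc (-(s + k)) (-s) := by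
    rw [range_closedWalk, image_neg_Ico]
  have left_zero : closedWalk q s k 0 = q s := by simp [closedWalk]
  have right_zero : closedWalk (fun a => q (-a)) s k 0 = q (-s) := by simp [closedWalk]
  have path_last : centeredPath q s (Fin.last (2 * s)) = q (-s) := by
    simp [centeredPath, two_mul]
  refine ⟨hk, closedWalk_injective (h.injOn.mono (by grind)), closedWalk_injective ?_,
    centeredPath_injective (h.injOn.mono (by grind)), ?_, ?_, ?_, ?_, ?_, ?_, ?_, ?_⟩
  · exact fun a ha b hb hab => neg_injective (h.injOn (by grind) (by grind) hab)
  · rw [range_left, range_right, Ne, h.injOn.image_eq_image_iff (by grind) (by grind)]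
    intro heq
    have last_mem : (s + k - 1 : ℤ) ∈ Set.Ico (s : ℤ) (s + k) := by grind
    rw [heq] at last_mem
    grind
  · simp [left_zero, centeredPath]
  · rw [right_zero, path_last]
  · simp [centeredPath]
  · rw [range_left, left_zero, range_centeredPath, h.image_inter_image (K := {(s : ℤ)})
      (by grind) (by grind), Set.image_singleton]
  · rw [range_right, right_zero, range_centeredPath, h.image_inter_image (K := {(-s : ℤ)})
      (by grind) (by grind), Set.image_singleton]
  · rw [range_left, range_right, range_centeredPath, h.image_inter_image (by grind) rfl]
    exact Set.image_mono (by grind)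
  · rintro rfl
    rw [← Set.range_comp]
    exact congrArg Set.range (funext fun j => h.map_apply _)

lemma injOn_gluedWalk {i t : ℤ} (h : IsSymmetricLollipop ρ q i t) (hi : 1 ≤ i) :
    Set.InjOn (gluedWalk q i t) (Set.Ico i (2 * t - i)) := by
  intro a ha b hb hab
  have := h.lt
  unfold gluedWalk at hab
  split_ifs at hab <;> have := h.injOn (by grind) (by grind) hab <;> grind

lemma gluedWalk_last {i t : ℤ} (h : IsSymmetricLollipop ρ q i t) (hclose : q t = q (-i)) :
    gluedWalk q i t (2 * t - i) = gluedWalk q i t i := by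
  have := h.lt
  rw [gluedWalk, gluedWalk, if_neg (by omega), if_pos this, ← h.apply_neg_last hclose]
  ring_nf

lemma isBisectedCycle (h : IsSymmetricLollipop ρ q s (s + k)) (hk : 2 ≤ k) (hs : 1 ≤ s)
    (hclose : q (s + k) = q (-s)) :
    IsBisectedCycle ρ (q 0) (closedWalk (gluedWalk q s (s + k)) s (2 * k))
      (centeredPath q s) := by
  have : NeZero k := ⟨by omega⟩
  have last_eq : (s : ℤ) + (2 * k : ℕ) = 2 * (s + k) - s := by push_cast; ring
  have glued_last := h.gluedWalk_last hclose
  rw [← last_eq] at glued_last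
  have cycle_zero : closedWalk (gluedWalk q s (s + k)) s (2 * k) 0 = q s := by
    simp only [closedWalk, ZMod.val_zero, Nat.cast_zero, add_zero]
    exact if_pos (by omega)
  have cycle_opposite : closedWalk (gluedWalk q s (s + k)) s (2 * k) k = q (-s) := by
    rw [closedWalk_natCast glued_last (by omega), gluedWalk, if_neg (lt_irrefl _)]
    ring_nf
  refine ⟨hk, hs, closedWalk_injective ?_, centeredPath_injective (h.injOn.mono (by grind)),
    ?_, ?_, ?_, ?_, ?_⟩
  · rw [last_eq]
    exact h.injOn_gluedWalk (by exact_mod_cast hs)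
  · simp [cycle_zero, centeredPath]
  · simp [cycle_opposite, centeredPath, two_mul]
  · simp [centeredPath]
  · rw [range_closedWalk, last_eq, image_gluedWalk_Ico, range_centeredPath,
      cycle_zero, cycle_opposite,
      h.image_inter_image (K := {(s : ℤ), (-s : ℤ)}) (by grind) (by grind), Set.image_pair]
  · rw [image_closedWalk_Icc glued_last (by omega), image_closedWalk_Icc glued_last le_rfl,
      Nat.cast_zero, add_zero, image_gluedWalk_Icc hclose, last_eq, image_gluedWalk_Icc_right,
      Set.image_image, ← Set.neg_Icc, ← Set.image_neg_eq_neg, Set.image_image]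
    exact Set.image_congr fun a _ => h.map_apply a

end IsSymmetricLollipop

end LollipopShapes

section CentralShapes

variable {V : Type*} {ρ : V → V} {q : ℤ → V} {i t : ℤ} {H : Graph V (Sym2 V)}

namespace IsSymmetricLollipop

lemma isTypeA (h : IsSymmetricLollipop ρ q i t) (hti : t = i + 1) (hclose : q t = q (-i))
    (hH : ConsistsOf H (q '' Set.Ioo (-t) t) (walkEdges q (Set.Ico (-t) t))) :
    IsTypeA H (q 0) := by
  have := h.nonneg
  lift i to ℕ using h.nonneg
  have last_eq : -(i : ℤ) + (2 * i + 1 : ℕ) = t := by push_cast; omega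
  have Ico_eq : Set.Ico (-i : ℤ) t = Set.Ioo (-t) t := by grind
  have closed : q (-(i : ℤ) + (2 * i + 1 : ℕ)) = q (-i) := by rw [last_eq, hclose]
  have range_cycle : Set.range (closedWalk q (-i) (2 * i + 1)) = q '' Set.Ioo (-t) t := by
    rw [range_closedWalk, last_eq, Ico_eq]
  refine ⟨2 * i + 1, closedWalk q (-i) (2 * i + 1), odd_two_mul_add_one i,
    closedWalk_injective (by rw [last_eq, Ico_eq]; exact h.injOn), ?_, ?_⟩
  · rw [range_cycle]
    exact ⟨0, by grind, rfl⟩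
  · rwa [range_cycle, cycleEdges_closedWalk closed, last_eq,
      h.walkEdges_eq_of_close_neg hti hclose]

lemma isTypeB (h : IsSymmetricLollipop ρ q i t) (hodd : Odd (t - i)) (hclose : q t = q i)
    (ht : 2 ≤ t) (hH : ConsistsOf H (q '' Set.Ioo (-t) t) (walkEdges q (Set.Ico (-t) t))) :
    IsTypeB H (q 0) ρ := by
  have hlt := h.lt
  lift i to ℕ using h.nonneg
  obtain ⟨k, hk⟩ := Int.eq_ofNat_of_zero_le (sub_nonneg.2 hlt.le)
  obtain rfl : t = i + k := by omega
  rw [hk, Int.odd_coe_nat] at hodd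
  have : NeZero k := ⟨hodd.pos.ne'⟩
  have close_neg : q (-(i + k : ℤ)) = q (-i) := by rw [← h.map_apply, hclose, h.map_apply]
  have d := h.isDumbbell hodd (by exact_mod_cast ht)
  refine ⟨k, i, _, _, _, hodd, d.left_injective, d.right_injective, d.path_injective, d.range_ne,
    d.path_zero, d.path_last, d.path_mid, d.left_inter_path, d.right_inter_path,
    d.left_inter_right, d.image_range, ?_⟩
  rw [range_closedWalk, range_closedWalk, image_neg_Ico, range_centeredPath,
    cycleEdges_closedWalk hclose, cycleEdges_closedWalk close_neg, walkEdges_neg,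
    pathEdges_centeredPath]
  unfold walkEdges at hH ⊢
  simp only [← Set.image_union]
  convert hH using 3 <;> grind

lemma isTypeC (h : IsSymmetricLollipop ρ q i t) (hi : 1 ≤ i) (hti : i + 2 ≤ t)
    (hclose : q t = q (-i))
    (hH : ConsistsOf H (q '' Set.Ioo (-t) t) (walkEdges q (Set.Ico (-t) t))) :
    IsTypeC H (q 0) ρ := by
  have hlt := h.lt
  lift i to ℕ using h.nonneg
  obtain ⟨k, hk⟩ := Int.eq_ofNat_of_zero_le (sub_nonneg.2 hlt.le)
  obtain rfl : t = i + k := by omega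
  have : NeZero k := ⟨by omega⟩
  have last_eq : (i : ℤ) + (2 * k : ℕ) = 2 * (i + k) - i := by push_cast; ring
  have d := h.isBisectedCycle (by omega) (by omega) hclose
  have closed : gluedWalk q i (i + k) (i + (2 * k : ℕ)) = gluedWalk q i (i + k) i := by
    rw [last_eq, h.gluedWalk_last hclose]
  refine ⟨k, i, _, _, d.two_le, d.one_le, d.cycle_injective, d.path_injective, d.path_zero,
    d.path_last, d.path_mid, d.cycle_inter_path, d.image_half, ?_⟩
  rw [range_closedWalk, range_centeredPath, cycleEdges_closedWalk closed, pathEdges_centeredPath,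
    last_eq, image_gluedWalk_Ico, walkEdges_gluedWalk hclose]
  unfold walkEdges at hH ⊢
  simp only [← Set.image_union]
  convert hH using 3 <;> grind

lemma isTypeA_or_isTypeB_or_isTypeC (h : IsSymmetricLollipop ρ q i t) (hodd : Odd (t - i))
    (hH : ConsistsOf H (q '' Set.Ioo (-t) t) (walkEdges q (Set.Ico (-t) t))) :
    IsTypeA H (q 0) ∨ IsTypeB H (q 0) ρ ∨ IsTypeC H (q 0) ρ := by
  have := h.nonneg
  have := h.lt
  by_cases hA : t = i + 1 ∧ q t = q (-i)
  · exact Or.inl (h.isTypeA hA.1 hA.2 hH)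
  rcases h.close with hclose | hclose
  · refine Or.inr (Or.inl (h.isTypeB hodd hclose ?_ hH))
    by_contra! ht
    obtain rfl : i = 0 := by omega
    exact hA ⟨by omega, by rw [hclose, neg_zero]⟩
  · have hti : i + 2 ≤ t := by
      by_contra! hti
      exact hA ⟨by omega, hclose⟩
    rcases eq_or_lt_of_le h.nonneg with rfl | hi
    · exact Or.inr (Or.inl (h.isTypeB hodd (by rw [hclose, neg_zero]) (by omega) hH))
    · exact Or.inr (Or.inr (h.isTypeC hi hti hclose hH))

end IsSymmetricLollipop

end CentralShapes

section Components

variable {V : Type*} {q : ℤ → V}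

lemma consistsOf_componentOf {G : Graph V (Sym2 V)} {c : V} {W : Set V} {F : Set (Sym2 V)}
    (hc : c ∈ W) (hreach : ∀ x ∈ W, GraphReachable G c x)
    (hW : ∀ x ∈ W, ∀ y, G.Adj x y → y ∈ W)
    (hF : ∀ x y, s(x, y) ∈ F ↔ G.Adj x y ∧ x ∈ W ∧ y ∈ W) : ConsistsOf (componentOf G c) W F := by
  have component_eq : {v | GraphReachable G c v} = W := by
    refine Set.Subset.antisymm (fun v hv => ?_) hreach
    induction hv with
    | refl => exact hc
    | tail _ hadj ih => exact hW _ ih _ hadj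
  refine ⟨component_eq, fun x y => ?_⟩
  rw [hF, componentOf, component_eq]
  exact ⟨fun ⟨e, he, hx, hy⟩ => ⟨⟨e, he⟩, hx, hy⟩, fun ⟨⟨e, he⟩, hx, hy⟩ => ⟨e, he, hx, hy⟩⟩

lemma graphReachable_walk {G : Graph V (Sym2 V)} {t : ℤ}
    (hq : ∀ a ∈ Set.Ico (-t) t, G.Adj (q a) (q (a + 1))) {a : ℤ} (ha : a ∈ Set.Ioo (-t) t) :
    GraphReachable G (q 0) (q a) := by
  induction a using Int.induction_on with
  | zero => exact .refl
  | succ m ih => exact (ih (by grind)).tail (hq _ (by grind))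
  | pred m ih =>
    refine (ih (by grind)).tail ?_
    have := (hq (-m - 1) (by grind)).symm
    rwa [sub_add_cancel] at this

end Components

section DoublyStochastic

variable {V : Type*} [Fintype V] {ρ : V → V} {E : Set (Sym2 V)} {X : Matrix V V ℝ}

lemma IsBisymmetric.isPendantFree_entrySupport (hX : IsBisymmetric ρ E X)
    (hnonneg : ∀ x y, 0 ≤ X x y) (hrow : rowSum X = 1) : IsPendantFree (entrySupport X) := by
  classical
  have sum_eq_one (x : V) : ∑ y, X x y = 1 := by rw [← rowSum_apply, hrow, Pi.one_apply]
  constructor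
  · intro x
    obtain ⟨y, -, hy⟩ := Finset.exists_ne_zero_of_sum_ne_zero
      (ne_of_eq_of_ne (sum_eq_one x) one_ne_zero)
    exact ⟨y, hX.mk_mem_entrySupport.2 hy⟩
  · simp only [hX.mk_mem_entrySupport]
    intro x y z _ hxz hzy
    by_contra! h
    have apply_eq_one : X x y = 1 := by
      rw [hX.symm, ← sum_eq_one y, Finset.sum_eq_single x (fun u _ hu => h u hu) (by simp)]
    have pair_le : X x z + X x y ≤ 1 := by
      rw [← sum_eq_one x, ← Finset.sum_pair hzy]
      exact Finset.sum_le_sum_of_subset_of_nonneg (Finset.subset_univ _) fun u _ _ => hnonneg x u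
    exact hxz ((hnonneg x z).antisymm' (by linarith))

end DoublyStochastic

section CentralType

variable {n : ℕ} {A : Matrix (Fin n) (Fin n) ℝ}

lemma rev_eq_self_iff (hn : Odd n) (x : Fin n) : x.rev = x ↔ x = centralVertex hn := by
  obtain ⟨m, rfl⟩ := hn
  simp only [Fin.ext_iff, Fin.val_rev, centralVertex]
  omega

lemma entrySupport_eq_of_consistsOf {S : Set (Fin n)} {F : Set (Sym2 (Fin n))}
    (h : ConsistsOf (loopyGraph A) S F) : entrySupport A = F := by
  ext ⟨x, y⟩
  rw [← loopyGraph_adj, h.2]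

lemma IsTypeA.isRigid {c : Fin n} {ρ : Fin n → Fin n} (h : IsTypeA (loopyGraph A) c) :
    IsRigid ρ (entrySupport A) := by
  obtain ⟨k, w, hk, hw, -, hA⟩ := h
  exact entrySupport_eq_of_consistsOf hA ▸ isRigid_cycleEdges hk hw

lemma IsTypeB.isRigid {c : Fin n} {ρ : Fin n → Fin n} (h : IsTypeB (loopyGraph A) c ρ)
    (hc : ∀ x, ρ x = x ↔ x = c)
    (hEρ : Set.MapsTo (Sym2.map ρ) (entrySupport A) (entrySupport A)) :
    IsRigid ρ (entrySupport A) := by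
  obtain ⟨k, s, w, w', p, hk, hw, hw', hp, hne, h0, hlast, hmid, hl, hr, hlr, hs, hA⟩ := h
  have hd : IsDumbbell ρ c w w' p := ⟨hk, hw, hw', hp, hne, h0, hlast, hmid, hl, hr, hlr, hs⟩
  rw [entrySupport_eq_of_consistsOf hA] at hEρ ⊢
  exact hd.isRigid hc hEρ

lemma IsTypeC.isRigid {E : Set (Sym2 (Fin n))} {c : Fin n} {ρ : Fin n → Fin n}
    (h : IsTypeC (loopyGraph A) c ρ) (hρ : Function.Involutive ρ) (hc : ∀ x, ρ x = x ↔ x = c)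
    (hA : IsBisymmetric ρ E A) (hrow : rowSum A = 1) : IsRigid ρ (entrySupport A) := by
  obtain ⟨l, s, w, p, hl, hs, hw, hp, h0, hlast, hmid, hwp, hhalf, hcons⟩ := h
  have hd : IsBisectedCycle ρ c w p := ⟨hl, hs, hw, hp, h0, hlast, hmid, hwp, hhalf⟩
  have hEρ := hA.mapsTo_entrySupport
  have hAE := hA.self_entrySupport
  rw [entrySupport_eq_of_consistsOf hcons] at hEρ hAE ⊢
  exact hd.isRigid hρ hc hEρ (hd.odd hρ hc hEρ hAE hrow)

lemma isRigid_of_isCentralType (hn : Odd n) (hA : A ∈ OmegaTH n)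
    (h : IsCentralType hn (loopyGraph A)) : IsRigid Fin.rev (entrySupport A) := by
  obtain ⟨-, hsymm, hrow⟩ := mem_OmegaTH_iff.1 hA
  have hc := rev_eq_self_iff hn
  rcases h with h | h | h
  · exact h.isRigid
  · exact h.isRigid hc hsymm.mapsTo_entrySupport
  · exact h.isRigid Fin.rev_involutive hc hsymm hrow

lemma exists_consistsOf_componentOf (hn : Odd n) (hA : A ∈ OmegaTH n)
    (hE : IsRigid Fin.rev (entrySupport A)) :
    ∃ q i t, IsSymmetricLollipop Fin.rev q i t ∧ Odd (t - i) ∧ q 0 = centralVertex hn ∧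
      ConsistsOf (componentOf (loopyGraph A) (centralVertex hn)) (q '' Set.Ioo (-t) t)
        (walkEdges q (Set.Ico (-t) t)) := by
  obtain ⟨hnonneg, hsymm, hrow⟩ := mem_OmegaTH_iff.1 hA
  have hc := rev_eq_self_iff hn
  have hρ : Function.Involutive (Fin.rev : Fin n → Fin n) := Fin.rev_involutive
  have hEρ := hsymm.mapsTo_entrySupport
  have hpend := hsymm.isPendantFree_entrySupport hnonneg hrow
  obtain ⟨q, i, t, h, q_zero, hq⟩ := hpend.exists_isSymmetricLollipop hρ hc hEρ
  have hodd := h.odd hE hρ hEρ hq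
  have center_mem : centralVertex hn ∈ q '' Set.Ioo (-t) t :=
    ⟨0, by grind [h.nonneg, h.lt], q_zero⟩
  have hspan := h.isSpanned hρ hodd hq
  refine ⟨q, i, t, h, hodd, q_zero, consistsOf_componentOf center_mem ?_ ?_ ?_⟩
  · rintro _ ⟨a, ha, rfl⟩
    rw [← q_zero]
    exact graphReachable_walk (fun b hb => loopyGraph_adj.2 (hq ⟨b, hb, rfl⟩)) ha
  · exact fun x hx y hxy => hspan.mem_of_mem hE hpend hρ hEρ
      (fun z hz => (hc z).1 hz ▸ center_mem) hx (loopyGraph_adj.1 hxy)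
  · simp only [loopyGraph_adj, h.mem_walkEdges_iff hE hρ hEρ hq, implies_true]

end CentralType

theorem mainTheorem2 (n : ℕ) (hn : Odd n) :
    (∀ A ∈ Set.extremePoints ℝ (OmegaTH n),
      IsCentralType hn (componentOf (loopyGraph A) (centralVertex hn))) ∧
    (∀ A ∈ OmegaTH n, GraphConnected (loopyGraph A) → IsCentralType hn (loopyGraph A) →
      A ∈ Set.extremePoints ℝ (OmegaTH n)) := by
  constructor
  · intro A hA
    obtain ⟨q, i, t, h, hodd, q_zero, hcomponent⟩ := exists_consistsOf_componentOf hn hA.1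
      ((mem_extremePoints_OmegaTH_iff hA.1).1 hA)
    have := h.isTypeA_or_isTypeB_or_isTypeC hodd hcomponent
    rwa [q_zero] at this
  · exact fun A hA _ htype =>
      (mem_extremePoints_OmegaTH_iff hA).2 (isRigid_of_isCentralType hn hA htype)
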